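/- Let $\lambda_m,\lambda_r,R,T,A>0$, $\alpha>2$ and $\tau_m\in\{1,2,\dots\}$. Transmitters $(x_j)$ form a homogeneous Poisson point process on $\mathbb R^2$ with intensity $\lambda_m$. Each transmitter $x_j$ has a finite random collection of receivers (a point process, not necessarily Poisson); given the transmitters, these collections are independent, the law of the $j$-th one depends only on $x_j$, and its intensity measure is $\lambda_r\,\mathrm{vol}(\,\cdot\cap B(x_j,R))$. For a receiver $y$ of $x_j$ and a time $n\in\{1,\dots,\tau_m\}$, let (no noise, path loss $\ell(r)=Ar^{\alpha}$) $$\mathrm{SINR}_{y,x_j}(n)=\frac{F_{y,x_j}(n)/\ell(\|y-x_j\|)}{\sum_{i\ne j}F_{y,x_i}(n)/\ell(\|y-x_i\|)},$$ where the fading variables $F_{y,x_i}(n)$ are i.i.d. $\mathrm{Exp}(1)$ over receivers, transmitters and times, and independent of all positions. The receiver $y$ is covered if $\mathrm{SINR}_{y,x_j}(n)\ge T$ for some $n\in\{1,\dots,\tau_m\}$; let $N_j$ be the number of covered receivers of $x_j$. The mean number of covered receivers in the typical cluster is the Palm expectation $$\mathbb E^o[N]=\frac{1}{\lambda_m|B|}\,\mathbb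 E\Big[\sum_{j:\,x_j\in B}N_j\Big],$$ where $B\subset\mathbb R^2$ is any Borel set with area $0<|B|<\infty$. Put $$K(\alpha,n)=\frac{2\pi}{\alpha}\int_0^\infty t^{-\frac2\alpha-1}\Big(1-\frac1{(1+t)^n}\Big)\,dt,\qquad \tilde K(\alpha,\tau_m)=\sum_{n=1}^{\tau_m}(-1)^{n+1}\binom{\tau_m}{n}\frac1{K(\alpha,n)}.$$ Then, for every such $B$, $\mathbb E^o[N]$ is finite and $$\mathbb E^o[N]=\frac{\pi\lambda_r}{T^{2/\alpha}\lambda_m}\sum_{n=1}^{\tau_m}(-1)^{n+1}\binom{\tau_m}{n}\frac1{K(\alpha,n)}\Big(1-e^{-\lambda_mK(\alpha,n)T^{2/\alpha}R^2}\Big).$$ In particular, as $\lambda_m\to\infty$ with all other parameters fixed, $$\mathbb E^o[N]\sim\frac{\pi\,\tilde K(\alpha,\tau_m)\,\lambda_r}{T^{2/\alpha}\lambda_m}.$$ -/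

import Mathlib

open MeasureTheory ProbabilityTheory Filter Asymptotics
open scoped ENNReal NNReal Topology

noncomputable section

namespace MulticastD2D

/-- The Euclidean plane. -/
abbrev Plane : Type := EuclideanSpace ℝ (Fin 2)

/-- A finite configuration of receivers: the number `c.1` of receivers and their positions
`c.2 0, …, c.2 (c.1 - 1)` (the later entries of the sequence carry no meaning). -/
abbrev Cluster : Type := ℕ × (ℕ → Plane)

/-- The number of receivers of the configuration `c` in the set `D`. -/
def Cluster.count (c : Cluster) (D : Set Plane) : ℝ≥0∞ :=
  ∑ k ∈ Finset.range c.1, D.indicator (fun _ => 1) (c.2 k)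

/-- The random measure `Φ` is a Poisson point process with intensity measure `Λ`: the number of
points in a set of finite intensity is Poisson distributed, and the numbers of points in finitely
many pairwise disjoint such sets are independent. -/
structure IsPoissonProcess {E Ω : Type*} [MeasurableSpace E] [MeasurableSpace Ω]
    (Φ : Ω → Measure E) (Λ : Measure E) (P : Measure Ω) : Prop where
  law : ∀ A : Set E, MeasurableSet A → Λ A ≠ ∞ →
    HasLaw (fun ω => Φ ω A) ((poissonMeasure (Λ A).toNNReal).map (Nat.cast : ℕ → ℝ≥0∞)) P
  indep : ∀ (m : ℕ) (A : Fin m → Set E), (∀ i, MeasurableSet (A i)) → (∀ i, Λ (A i) ≠ ∞) →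
    Pairwise (fun i j => Disjoint (A i) (A j)) → iIndepFun (fun i ω => Φ ω (A i)) P

/-- The network on the probability space `(Ω, P)`: transmitters of density `lamM`, each with its
cluster of receivers of density `lamR` in the disc of radius `R` around the transmitter, and
Rayleigh fading. -/
structure Network (Ω : Type*) [MeasurableSpace Ω] (P : Measure Ω) (lamM lamR R : ℝ) where
  /-- the positions of the transmitters -/
  tx : ℕ → Ω → Plane
  tx_measurable : ∀ j, Measurable (tx j)
  /-- the transmitters form a homogeneous Poisson point process of intensity `lamM` -/
  tx_poisson : IsPoissonProcess (fun ω => Measure.sum fun j => Measure.dirac (tx j ω))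
    (ENNReal.ofReal lamM • (volume : Measure Plane)) P
  /-- the cluster of intended receivers of the `j`-th transmitter -/
  cluster : ℕ → Ω → Cluster
  cluster_measurable : ∀ j, Measurable (cluster j)
  /-- the law of the cluster of a transmitter at a given position -/
  clusterLaw : Kernel Plane Cluster
  clusterLaw_markov : IsMarkovKernel clusterLaw
  /-- the receivers of a transmitter at `x` have intensity measure `lamR · vol(· ∩ B(x, R))` -/
  clusterLaw_intensity : ∀ (x : Plane) (D : Set Plane), MeasurableSet D →
    ∫⁻ c, Cluster.count c D ∂(clusterLaw x) =
      ENNReal.ofReal lamR * volume (D ∩ Metric.ball x R)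
  /-- the clusters are independent marks: given the transmitters they are independent, and the
  `j`-th one has law `clusterLaw` at the position of the `j`-th transmitter -/
  cluster_indep_marks : ∀ (S : Set (ℕ → Plane)) (s : Finset ℕ) (C : ℕ → Set Cluster),
    MeasurableSet S → (∀ j, MeasurableSet (C j)) →
    P {ω | (fun j => tx j ω) ∈ S ∧ ∀ j ∈ s, cluster j ω ∈ C j} =
      ∫⁻ ω in {ω | (fun j => tx j ω) ∈ S}, ∏ j ∈ s, clusterLaw (tx j ω) (C j) ∂P
  /-- `fading j k i n` is the power fading, at time `n`, of the link from the `i`-th transmitter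
  to the `k`-th receiver of the `j`-th cluster -/
  fading : ℕ → ℕ → ℕ → ℕ → Ω → ℝ
  fading_measurable : ∀ j k i n, Measurable (fading j k i n)
  fading_law : ∀ j k i n, HasLaw (fading j k i n) (expMeasure 1) P
  /-- the fading variables are independent across space and time -/
  fading_iIndep : iIndepFun
    (fun q : ℕ × ℕ × ℕ × ℕ => fading q.1 q.2.1 q.2.2.1 q.2.2.2) P
  /-- the fading is independent of the positions of all nodes -/
  fading_indep_positions : IndepFun
    (fun ω (q : ℕ × ℕ × ℕ × ℕ) => fading q.1 q.2.1 q.2.2.1 q.2.2.2 ω)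
    (fun ω => ((fun j => tx j ω), (fun j => cluster j ω))) P

namespace Network

variable {Ω : Type*} [MeasurableSpace Ω] {P : Measure Ω} {lamM lamR R : ℝ}

/-- The position of the `k`-th receiver of the `j`-th transmitter. -/
def rx (N : Network Ω P lamM lamR R) (j k : ℕ) (ω : Ω) : Plane := (N.cluster j ω).2 k

/-- The normalized power received at time `n` by the `k`-th receiver of the `j`-th cluster from the
`i`-th transmitter, for the path loss function `ℓ`. -/
def power (N : Network Ω P lamM lamR R) (ℓ : ℝ → ℝ) (j k i n : ℕ) (ω : Ω) : ℝ≥0∞ :=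
  ENNReal.ofReal (N.fading j k i n ω) / ENNReal.ofReal (ℓ (dist (N.tx i ω) (N.rx j k ω)))

/-- The SINR at time `n` of the link from the `j`-th transmitter to its `k`-th receiver; `W` is
the ratio of the noise power to the transmit power. -/
def sinr (N : Network Ω P lamM lamR R) (ℓ : ℝ → ℝ) (W : ℝ) (j k n : ℕ) (ω : Ω) : ℝ≥0∞ :=
  N.power ℓ j k j n ω /
    (ENNReal.ofReal W + ∑' i : ℕ, if i = j then 0 else N.power ℓ j k i n ω)

/-- The `k`-th receiver of the `j`-th cluster is covered: its SINR reaches the threshold `T` in at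
least one of the `τ` transmissions. -/
def Covered (N : Network Ω P lamM lamR R) (ℓ : ℝ → ℝ) (W T : ℝ) (τ j k : ℕ) (ω : Ω) : Prop :=
  ∃ n ∈ Finset.Icc 1 τ, ENNReal.ofReal T ≤ N.sinr ℓ W j k n ω

open Classical in
/-- The number of covered receivers in the `j`-th cluster. -/
def numCovered (N : Network Ω P lamM lamR R) (ℓ : ℝ → ℝ) (W T : ℝ) (τ j : ℕ) (ω : Ω) : ℕ :=
  ((Finset.range (N.cluster j ω).1).filter fun k => N.Covered ℓ W T τ j k ω).card

/-- The Palm expectation, with respect to the transmitter process, of a quantity `X` attached to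
the transmitters (`X j` belongs to the `j`-th one), computed over the window `B`:
`𝔼° X = (λ_m |B|)⁻¹ 𝔼 [∑_{x_j ∈ B} X_j]`. -/
def palmExpectation (N : Network Ω P lamM lamR R) (B : Set Plane) (X : ℕ → Ω → ℝ≥0∞) : ℝ≥0∞ :=
  (∫⁻ ω, ∑' j : ℕ, B.indicator (fun _ => X j ω) (N.tx j ω) ∂P) /
    (ENNReal.ofReal lamM * volume B)

/-- The mean number of covered receivers in the typical cluster. -/
def meanCovered (N : Network Ω P lamM lamR R) (B : Set Plane) (ℓ : ℝ → ℝ) (W T : ℝ) (τ : ℕ) :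
    ℝ≥0∞ :=
  N.palmExpectation B fun j ω => (N.numCovered ℓ W T τ j ω : ℝ≥0∞)

end Network

/-- `K(α, n) = (2π/α) ∫₀^∞ t^{-2/α-1} (1 - (1+t)^{-n}) dt`. -/
def K (α : ℝ) (n : ℕ) : ℝ :=
  2 * Real.pi / α * ∫ t in Set.Ioi (0 : ℝ), t ^ (-(2 / α) - 1) * (1 - 1 / (1 + t) ^ n)

/-- `K̃(α, τ) = ∑_{n=1}^τ (-1)^{n+1} C(τ, n) / K(α, n)`. -/
def Ktilde (α : ℝ) (τ : ℕ) : ℝ :=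
  ∑ n ∈ Finset.Icc 1 τ, (-1 : ℝ) ^ (n + 1) * (τ.choose n : ℝ) * (1 / K α n)

end MulticastD2D

end

/-! The quantity is a first moment, so dependence between the receivers of a cluster is irrelevant:
by linearity each cluster may be replaced by its intensity λ_r on the disc around its transmitter
(`Network.lintegral_sum_receivers`). What remains is the coverage probability of one link,
integrated over the receiver position and summed over the transmitters in `B`.

Given the positions, a transmission over a link of length r succeeds iff one Exp(1) variable
dominates a weighted sum of independent ones, which has probability p = ∏ 1/(1 + Tℓ(r)/ℓ(s_i)), the
product running over the interferers, at distances s_i from the receiver (`measure_le_sirAt`).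
Different times are independent given the positions, so coverage has conditional probability 1 - (1
- p)^τ = ∑ (-1)^{n+1} C(τ,n) p^n. The same positions serve all times, so the moments of p are
needed, not only its mean. Now p^n is again a product over the interferers, that is, the exponential
of minus a sum over the Poisson process. The reduced Mecke formula and the Laplace functional give
exp(-λ_m ∫ (1 - (1 + T r^α/|z|^α)^{-n}) dz), and t = T(r/s)^α turns this into exp(-λ_m K(α,n)
T^{2/α} r²) (`lintegral_one_sub_expNeg`); A cancels. A Gaussian integral over the disc then yields
the formula.

The Poisson hypothesis only concerns counts. It gives the Laplace functional, whose derivative in a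
second direction gives the Mecke formula for a fixed exponent
(`IsPoissonProcess.lintegral_expNeg_mul_tsum`, `IsPoissonProcess.mecke_expNeg`). Here the exponent
also depends on the distinguished point x, but, once the receiver y is fixed, only through |x - y|
and monotonically; a sandwich between discretised radii covers this case
(`IsPoissonProcess.mecke_expNeg_monotone`).

In the dense limit the exponentials vanish and K̃ remains. Equivalence needs K̃ > 0, which is not
evident from an alternating sum; it follows because extra transmissions never lower coverage, so
K̃(α,τ) ≥ K̃(α,1) = 1/K(α,1). -/

namespace MulticastD2D

/-! ### Exponential and logarithm on [0, ∞], and bounded approximations of the identity -/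

/-- The function `exp (-x)` on `[0, ∞]`, with `exp (-∞) = 0`. -/
noncomputable def expNeg (x : ℝ≥0∞) : ℝ≥0∞ := EReal.exp (-(x : EReal))

/-- The function `-log u` on `[0, ∞]`, truncated to `0` for `u ≥ 1`. -/
noncomputable def negLog (u : ℝ≥0∞) : ℝ≥0∞ := (-ENNReal.log u).toENNReal

@[simp] lemma expNeg_zero : expNeg 0 = 1 := by simp [expNeg]

@[simp] lemma expNeg_top : expNeg ∞ = 0 := by simp [expNeg]

lemma expNeg_antitone : Antitone expNeg := fun x y h => by
  unfold expNeg
  rw [EReal.exp_le_exp_iff, EReal.neg_le_neg_iff]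
  exact_mod_cast h

lemma expNeg_le_one (x : ℝ≥0∞) : expNeg x ≤ 1 := by
  simpa using expNeg_antitone (bot_le : 0 ≤ x)

lemma expNeg_ne_top (x : ℝ≥0∞) : expNeg x ≠ ∞ :=
  ((expNeg_le_one x).trans_lt ENNReal.one_lt_top).ne

lemma expNeg_add (x y : ℝ≥0∞) : expNeg (x + y) = expNeg x * expNeg y := by
  unfold expNeg
  rw [← EReal.exp_add, EReal.coe_ennreal_add, EReal.neg_add, sub_eq_add_neg] <;> simp

lemma expNeg_sum {ι : Type*} (s : Finset ι) (f : ι → ℝ≥0∞) :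
    expNeg (∑ i ∈ s, f i) = ∏ i ∈ s, expNeg (f i) := by
  classical
  induction s using Finset.induction_on with
  | empty => simp
  | insert a s ha ih => rw [Finset.sum_insert ha, Finset.prod_insert ha, expNeg_add, ih]

lemma expNeg_nat_mul (n : ℕ) (x : ℝ≥0∞) : expNeg (n * x) = expNeg x ^ n := by
  simpa using expNeg_sum (Finset.range n) (fun _ => x)

lemma continuous_expNeg : Continuous expNeg :=
  ENNReal.continuous_exp.comp (continuous_neg.comp continuous_coe_ennreal_ereal)

lemma measurable_expNeg : Measurable expNeg := continuous_expNeg.measurable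

lemma expNeg_ofReal {x : ℝ} (hx : 0 ≤ x) :
    expNeg (ENNReal.ofReal x) = ENNReal.ofReal (Real.exp (-x)) := by
  unfold expNeg
  rw [EReal.coe_ennreal_ofReal, max_eq_left hx, ← EReal.coe_neg, EReal.exp_coe]

lemma expNeg_negLog {u : ℝ≥0∞} (hu : u ≤ 1) : expNeg (negLog u) = u := by
  unfold expNeg negLog
  rw [EReal.coe_toENNReal, neg_neg, ENNReal.exp_log]
  rw [EReal.le_neg, neg_zero]
  simpa using hu

@[simp] lemma negLog_one : negLog 1 = 0 := by simp [negLog]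

lemma negLog_antitone : Antitone negLog := fun x y h => by
  unfold negLog
  apply EReal.toENNReal_le_toENNReal
  rw [EReal.neg_le_neg_iff]
  exact ENNReal.log_monotone h

lemma negLog_ne_top {u : ℝ≥0∞} (hu : u ≠ 0) : negLog u ≠ ∞ := by
  simp [negLog, hu]

lemma measurable_negLog : Measurable negLog := negLog_antitone.measurable

lemma expNeg_eq_zero {x : ℝ≥0∞} : expNeg x = 0 ↔ x = ∞ := by
  simp [expNeg]

/-- Approximations of the identity of `[0, ∞]` by bounded functions built from `expNeg`. -/
noncomputable def expSlope (k : ℕ) (x : ℝ≥0∞) : ℝ≥0∞ := 2 ^ k * (1 - expNeg (x / 2 ^ k))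

lemma expSlope_monotone (k : ℕ) : Monotone (expSlope k) := fun x y h => by
  unfold expSlope
  gcongr
  exact expNeg_antitone (by gcongr)

lemma continuous_expSlope (k : ℕ) : Continuous (expSlope k) := by
  unfold expSlope
  refine ENNReal.continuous_const_mul (by simp) |>.comp ?_
  refine (ENNReal.continuous_sub_left ENNReal.one_ne_top).comp ?_
  exact continuous_expNeg.comp (ENNReal.continuous_div_const _ (by simp))

/-- With q = exp(-x/2^(k+1)) this is 1 - q² ≤ 2(1 - q). Monotonicity in `k` lets monotone
convergence replace any integrability assumption when the Laplace functional is differentiated. -/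
lemma expSlope_le_succ (k : ℕ) (x : ℝ≥0∞) : expSlope k x ≤ expSlope (k + 1) x := by
  unfold expSlope
  have h : x / 2 ^ k = x / 2 ^ (k + 1) + x / 2 ^ (k + 1) := by
    rw [← ENNReal.mul_div_mul_left x (2 ^ k) (c := 2) (by simp) (by simp), two_mul, pow_succ',
      ENNReal.add_div]
  rw [h, expNeg_add]
  have hq : expNeg (x / 2 ^ (k + 1)) ≤ 1 := expNeg_le_one _
  have hqt := expNeg_ne_top (x / 2 ^ (k + 1))
  generalize expNeg (x / 2 ^ (k + 1)) = q at hq hqt ⊢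
  rw [pow_succ, mul_assoc]
  gcongr
  lift q to ℝ≥0 using hqt
  have hq' : q ≤ 1 := by exact_mod_cast hq
  have : (1 : ℝ≥0) - q * q ≤ 2 * (1 - q) := by
    rw [← NNReal.coe_le_coe]
    rw [NNReal.coe_sub (mul_le_one' hq' hq'), NNReal.coe_mul, NNReal.coe_mul, NNReal.coe_sub hq']
    push_cast
    nlinarith [sq_nonneg (1 - (q : ℝ))]
  exact_mod_cast this

lemma expSlope_mono (x : ℝ≥0∞) : Monotone fun k => expSlope k x :=
  monotone_nat_of_le_succ fun k => expSlope_le_succ k x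

lemma tendsto_expSlope (x : ℝ≥0∞) : Tendsto (fun k => expSlope k x) atTop (𝓝 x) := by
  have h2 : Tendsto (fun k : ℕ => (2 : ℝ≥0∞) ^ k) atTop (𝓝 ∞) :=
    ENNReal.tendsto_pow_atTop_nhds_top_iff.2 (by norm_num)
  by_cases hx : x = ∞
  · subst hx
    unfold expSlope
    simp [ENNReal.top_div]
  · lift x to ℝ≥0 using hx
    have key : ∀ k : ℕ, expSlope k x =
        ENNReal.ofReal ((2 : ℝ) ^ k * (1 - Real.exp (-(x / 2 ^ k)))) := by
      intro k
      unfold expSlope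
      have : (x : ℝ≥0∞) / 2 ^ k = ENNReal.ofReal (x / 2 ^ k) := by
        rw [ENNReal.ofReal_div_of_pos (by positivity), ENNReal.ofReal_pow (by norm_num)]
        simp
      rw [this, expNeg_ofReal (by positivity), ENNReal.ofReal_mul (by positivity),
        ENNReal.ofReal_sub _ (by positivity), ENNReal.ofReal_pow (by norm_num)]
      simp
    simp_rw [key]
    -- `expSlope k x` is the difference quotient of 1 - exp(-xt) at t = 0 with step 2^(-k), so it
    -- tends to the derivative x.
    have hd : HasDerivAt (fun t : ℝ => 1 - Real.exp (-(x * t))) x 0 := by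
      have := ((((hasDerivAt_id (0 : ℝ)).const_mul (x : ℝ)).neg).exp).const_sub 1
      simpa using this
    have h0 : Tendsto (fun k : ℕ => ((2 : ℝ) ^ k)⁻¹) atTop (𝓝[≠] 0) := by
      refine tendsto_nhdsWithin_iff.2 ⟨?_, Eventually.of_forall fun k => by simp⟩
      exact tendsto_inv_atTop_zero.comp (tendsto_pow_atTop_atTop_of_one_lt (by norm_num))
    have := (hd.tendsto_slope_zero).comp h0
    have h3 := ENNReal.tendsto_ofReal this
    rw [ENNReal.ofReal_coe_nnreal] at h3
    refine h3.congr fun k => ?_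
    simp [div_eq_mul_inv]

lemma expSlope_le (k : ℕ) (x : ℝ≥0∞) : expSlope k x ≤ x :=
  (expSlope_mono x).ge_of_tendsto (tendsto_expSlope x) k

lemma tendsto_expSlope_of_monotone {y : ℕ → ℝ≥0∞} {x : ℝ≥0∞} (hy : Monotone y)
    (h : Tendsto y atTop (𝓝 x)) : Tendsto (fun k => expSlope k (y k)) atTop (𝓝 x) := by
  have hm : Monotone fun k => expSlope k (y k) := fun k l hkl =>
    (expSlope_mono _ hkl).trans (expSlope_monotone l (hy hkl))
  have ht := tendsto_atTop_iSup hm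
  have hle : (⨆ k, expSlope k (y k)) ≤ x :=
    iSup_le fun k => (expSlope_le k _).trans (hy.ge_of_tendsto h k)
  have hge : x ≤ ⨆ k, expSlope k (y k) := by
    refine le_of_tendsto' h fun l => ?_
    refine le_of_tendsto_of_tendsto (tendsto_expSlope (y l)) ht ?_
    filter_upwards [eventually_ge_atTop l] with k hk
    exact expSlope_monotone k (hy hk)
  rwa [le_antisymm hle hge] at ht

/-- The generating function of the Poisson law at q = exp(-a): e^{-r} ∑ (rq)^n/n! = e^{-(1-q)r}. The
value a = ∞ is included. -/
lemma lintegral_expNeg_poisson (r : ℝ≥0) (a : ℝ≥0∞) :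
    ∫⁻ n, expNeg (a * n) ∂((poissonMeasure r).map (Nat.cast : ℕ → ℝ≥0∞)) =
      expNeg ((1 - expNeg a) * r) := by
  have hm : Measurable fun x : ℝ≥0∞ => expNeg (a * x) :=
    measurable_expNeg.comp (measurable_const.mul measurable_id)
  rw [lintegral_map hm (measurable_of_countable _)]
  rw [poissonMeasure, lintegral_sum_measure]
  simp_rw [lintegral_smul_measure, lintegral_dirac]
  have hq : expNeg a ≤ 1 := expNeg_le_one a
  have hqt := expNeg_ne_top a
  simp_rw [mul_comm a, expNeg_nat_mul]
  generalize expNeg a = q at hq hqt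
  lift q to ℝ≥0 using hqt
  have hq' : q ≤ 1 := by exact_mod_cast hq
  have e1 : (1 - (q : ℝ≥0∞)) * r = ENNReal.ofReal ((1 - q) * r) := by
    rw [ENNReal.ofReal_mul (by simpa using hq'), ENNReal.ofReal_sub _ (by positivity)]
    simp
  rw [e1, expNeg_ofReal (x := (1 - (q : ℝ)) * r)
    (mul_nonneg (sub_nonneg.2 (by exact_mod_cast hq')) r.2)]
  have hs : HasSum (fun n : ℕ => Real.exp (-r) * ((r * q : ℝ) ^ n / n.factorial))
      (Real.exp (-r) * Real.exp (r * q)) := by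
    refine HasSum.mul_left _ ?_
    rw [Real.exp_eq_exp_ℝ]
    exact NormedSpace.expSeries_div_hasSum_exp (r * q : ℝ)
  rw [show -((1 - (q : ℝ)) * r) = -r + r * q by ring, Real.exp_add, ← hs.tsum_eq,
    ENNReal.ofReal_tsum_of_nonneg (fun n => by positivity) hs.summable]
  refine tsum_congr fun n => ?_
  rw [smul_eq_mul, ← ENNReal.ofReal_coe_nnreal (p := q), ← ENNReal.ofReal_pow q.coe_nonneg,
    ← ENNReal.ofReal_mul (by positivity), mul_pow]
  congr 1
  ring

/-! ### Laplace functional, Campbell and Mecke formulas of a Poisson process -/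

section Poisson

variable {E Ω : Type*} [MeasurableSpace E] [MeasurableSpace Ω] {P : Measure Ω}
  {X : ℕ → Ω → E} {Λ : Measure E}

lemma lintegral_sum_dirac (x : ℕ → E) {h : E → ℝ≥0∞} (hh : Measurable h) :
    ∫⁻ z, h z ∂(Measure.sum fun j => Measure.dirac (x j)) = ∑' j, h (x j) := by
  rw [lintegral_sum_measure]
  exact tsum_congr fun j => lintegral_dirac' _ hh

lemma measurable_tsum_comp (hX : ∀ j, Measurable (X j)) {h : E → ℝ≥0∞} (hh : Measurable h) :
    Measurable fun ω => ∑' j, h (X j ω) :=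
  Measurable.tsum fun j => hh.comp (hX j)

lemma measurable_sum_dirac_apply (hX : ∀ j, Measurable (X j)) {A : Set E}
    (hA : MeasurableSet A) :
    Measurable fun ω => (Measure.sum fun j => Measure.dirac (X j ω)) A := by
  have : ∀ ω, (Measure.sum fun j => Measure.dirac (X j ω)) A
      = ∑' j, A.indicator (fun _ => (1 : ℝ≥0∞)) (X j ω) := fun ω => by
    rw [← lintegral_sum_dirac (fun j => X j ω) (measurable_const.indicator hA)]
    rw [lintegral_indicator hA, setLIntegral_one]
  simp_rw [this]
  exact measurable_tsum_comp hX (measurable_const.indicator hA)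

/-- The sum of a simple function over the points is a linear combination of the counts on its
fibres, which are independent Poisson variables. -/
lemma IsPoissonProcess.laplace_simpleFunc (hX : ∀ j, Measurable (X j))
    (hP : IsPoissonProcess (fun ω => Measure.sum fun j => Measure.dirac (X j ω)) Λ P)
    (h : SimpleFunc E ℝ≥0∞) (hs : Λ (Function.support h) ≠ ∞) :
    ∫⁻ ω, expNeg (∑' j, h (X j ω)) ∂P = expNeg (∫⁻ z, (1 - expNeg (h z)) ∂Λ) := by
  classical
  -- The value 0 is dropped because its fibre may have infinite intensity; it contributes nothing to
  -- either side.
  set s : Finset ℝ≥0∞ := h.range.filter (· ≠ 0) with hsdef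
  have hA : ∀ v : ℝ≥0∞, MeasurableSet (h ⁻¹' {v}) := fun v => h.measurableSet_fiber v
  have hfin : ∀ v ∈ s, Λ (h ⁻¹' {v}) ≠ ∞ := fun v hv => by
    refine ne_top_of_le_ne_top hs (measure_mono fun z hz => ?_)
    simp only [Set.mem_preimage, Set.mem_singleton_iff] at hz
    simp only [Function.mem_support, hz]
    exact (Finset.mem_filter.1 hv).2
  have e1 : ∀ ω, ∑' j, h (X j ω) =
      ∑ v ∈ s, v * (Measure.sum fun j => Measure.dirac (X j ω)) (h ⁻¹' {v}) := fun ω => by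
    rw [← lintegral_sum_dirac (fun j => X j ω) h.measurable, SimpleFunc.lintegral_eq_lintegral,
      SimpleFunc.lintegral, hsdef, Finset.sum_filter_of_ne]
    intro v _ hv h0
    simp [h0] at hv
  have e2 : ∫⁻ z, (1 - expNeg (h z)) ∂Λ = ∑ v ∈ s, (1 - expNeg v) * Λ (h ⁻¹' {v}) := by
    have : ∀ z, 1 - expNeg (h z) = (h.map fun v => 1 - expNeg v) z := fun z => rfl
    simp_rw [this]
    rw [SimpleFunc.lintegral_eq_lintegral, SimpleFunc.map_lintegral, hsdef,
      Finset.sum_filter_of_ne]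
    intro v _ hv h0
    simp [h0] at hv
  have hind : iIndepFun (fun (v : s) ω =>
      expNeg (v.1 * (Measure.sum fun j => Measure.dirac (X j ω)) (h ⁻¹' {v.1}))) P := by
    have h1 := hP.indep s.card (fun i => h ⁻¹' {(s.equivFin.symm i).1}) (fun i => hA _)
      (fun i => hfin _ (s.equivFin.symm i).2) (fun i j hij => by
        refine Disjoint.preimage _ (Set.disjoint_singleton.2 fun h' => hij ?_)
        exact s.equivFin.symm.injective (Subtype.ext h'))
    have h2 := h1.precomp s.equivFin.injective
    simp only [Equiv.symm_apply_apply] at h2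
    exact h2.comp (fun v x => expNeg (v.1 * x)) fun v =>
      measurable_expNeg.comp (measurable_const.mul measurable_id)
  simp_rw [e1, e2, expNeg_sum]
  rw [← Finset.prod_coe_sort s, ← lintegral_congr fun ω => Finset.prod_coe_sort s _,
    lintegral_prod_eq_prod_lintegral_of_indepFun _ _ hind (fun v => ?_)]
  · refine Finset.prod_congr rfl fun v _ => ?_
    have hl := hP.law _ (hA v.1) (hfin v.1 v.2)
    have hm : Measurable fun x : ℝ≥0∞ => expNeg (v.1 * x) :=
      measurable_expNeg.comp (measurable_const.mul measurable_id)
    rw [← lintegral_map' (f := fun x => expNeg (v.1 * x)) hm.aemeasurable hl.aemeasurable,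
      hl.map_eq]
    have h3 := lintegral_expNeg_poisson (Λ (h ⁻¹' {v.1})).toNNReal v.1
    rw [ENNReal.coe_toNNReal (hfin v.1 v.2)] at h3
    exact h3
  · exact measurable_expNeg.comp (measurable_const.mul (measurable_sum_dirac_apply hX (hA _)))

variable [IsProbabilityMeasure P]

/-- The Laplace functional of a Poisson process. -/
lemma IsPoissonProcess.laplace [SigmaFinite Λ] (hX : ∀ j, Measurable (X j))
    (hP : IsPoissonProcess (fun ω => Measure.sum fun j => Measure.dirac (X j ω)) Λ P)
    {h : E → ℝ≥0∞} (hh : Measurable h) :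
    ∫⁻ ω, expNeg (∑' j, h (X j ω)) ∂P = expNeg (∫⁻ z, (1 - expNeg (h z)) ∂Λ) := by
  classical
  -- Truncation to the spanning sets gives supports of finite intensity while keeping the
  -- approximation increasing to `h`.
  let g : ℕ → SimpleFunc E ℝ≥0∞ := fun n => (SimpleFunc.eapprox h n).restrict (spanningSets Λ n)
  have hg : ∀ n z, g n z = (spanningSets Λ n).indicator (SimpleFunc.eapprox h n) z := fun n z =>
    SimpleFunc.restrict_apply _ (measurableSet_spanningSets Λ n) z
  have hmono : ∀ z, Monotone fun n => g n z := fun z m n hmn => by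
    simp only [hg]
    refine (Set.indicator_le_indicator_of_subset (monotone_spanningSets Λ hmn)
      (fun _ => bot_le) z).trans ?_
    exact Set.indicator_le_indicator (SimpleFunc.monotone_eapprox h hmn z)
  have hlim : ∀ z, Tendsto (fun n => g n z) atTop (𝓝 (h z)) := fun z => by
    refine (SimpleFunc.tendsto_eapprox hh z).congr' ?_
    filter_upwards [eventually_ge_atTop (spanningSetsIndex Λ z)] with n hn
    rw [hg, Set.indicator_of_mem]
    exact monotone_spanningSets Λ hn (mem_spanningSetsIndex Λ z)
  have hfin : ∀ n, Λ (Function.support (g n)) ≠ ∞ := fun n => by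
    refine ne_top_of_le_ne_top (measure_spanningSets_lt_top Λ n).ne (measure_mono fun z hz => ?_)
    by_contra hz'
    exact hz (by rw [hg, Set.indicator_of_notMem hz'])
  have hlap := fun n => hP.laplace_simpleFunc hX (g n) (hfin n)
  have l1 : ∀ ω, Tendsto (fun n => ∑' j, g n (X j ω)) atTop (𝓝 (∑' j, h (X j ω))) := fun ω => by
    have := lintegral_tendsto_of_tendsto_of_monotone
      (μ := Measure.sum fun j => Measure.dirac (X j ω)) (f := fun n z => g n z) (F := h)
      (fun n => (g n).measurable.aemeasurable) (ae_of_all _ hmono) (ae_of_all _ hlim)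
    rw [lintegral_sum_dirac _ hh] at this
    refine this.congr fun n => lintegral_sum_dirac _ (g n).measurable
  have l2 : Tendsto (fun n => ∫⁻ ω, expNeg (∑' j, g n (X j ω)) ∂P) atTop
      (𝓝 (∫⁻ ω, expNeg (∑' j, h (X j ω)) ∂P)) := by
    refine tendsto_lintegral_of_dominated_convergence (fun _ => 1)
      (fun n => measurable_expNeg.comp (measurable_tsum_comp hX (g n).measurable))
      (fun n => ae_of_all _ fun ω => expNeg_le_one _) (by simp)
      (ae_of_all _ fun ω => (continuous_expNeg.tendsto _).comp (l1 ω))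
  have l3 : Tendsto (fun n => ∫⁻ z, (1 - expNeg (g n z)) ∂Λ) atTop
      (𝓝 (∫⁻ z, (1 - expNeg (h z)) ∂Λ)) := by
    refine lintegral_tendsto_of_tendsto_of_monotone
      (fun n => (measurable_const.sub (measurable_expNeg.comp (g n).measurable)).aemeasurable)
      (ae_of_all _ fun z m n hmn => tsub_le_tsub_left (expNeg_antitone (hmono z hmn)) 1)
      (ae_of_all _ fun z => ?_)
    exact ((ENNReal.continuous_sub_left ENNReal.one_ne_top).comp continuous_expNeg).tendsto _
      |>.comp (hlim z)
  refine tendsto_nhds_unique l2 ?_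
  simp_rw [hlap]
  exact (continuous_expNeg.tendsto _).comp l3

/-- The expectation of a sum over a Poisson process weighted by an exponential functional. -/
lemma IsPoissonProcess.lintegral_expNeg_mul_tsum [SigmaFinite Λ] (hX : ∀ j, Measurable (X j))
    (hP : IsPoissonProcess (fun ω => Measure.sum fun j => Measure.dirac (X j ω)) Λ P)
    {h g : E → ℝ≥0∞} (hh : Measurable h) (hg : Measurable g) :
    ∫⁻ ω, expNeg (∑' j, h (X j ω)) * ∑' j, g (X j ω) ∂P =
      expNeg (∫⁻ z, (1 - expNeg (h z)) ∂Λ) * ∫⁻ z, expNeg (h z) * g z ∂Λ := by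
  have mh := measurable_tsum_comp hX hh
  have mg := measurable_tsum_comp hX hg
  have eh := measurable_expNeg.comp hh
  have l1 : Tendsto (fun k => ∫⁻ ω, expNeg (∑' j, h (X j ω)) * expSlope k (∑' j, g (X j ω)) ∂P)
      atTop (𝓝 (∫⁻ ω, expNeg (∑' j, h (X j ω)) * ∑' j, g (X j ω) ∂P)) := by
    refine lintegral_tendsto_of_tendsto_of_monotone (fun k => ((measurable_expNeg.comp mh).mul
      ((continuous_expSlope k).measurable.comp mg)).aemeasurable)
      (ae_of_all _ fun ω k l hkl => mul_le_mul_right (expSlope_mono _ hkl) _)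
      (ae_of_all _ fun ω => ?_)
    exact ENNReal.Tendsto.const_mul (tendsto_expSlope _) (Or.inr (expNeg_ne_top _))
  have l2 : Tendsto (fun k => ∫⁻ z, expNeg (h z) * expSlope k (g z) ∂Λ)
      atTop (𝓝 (∫⁻ z, expNeg (h z) * g z ∂Λ)) := by
    refine lintegral_tendsto_of_tendsto_of_monotone (fun k => (eh.mul
      ((continuous_expSlope k).measurable.comp hg)).aemeasurable)
      (ae_of_all _ fun ω k l hkl => mul_le_mul_right (expSlope_mono _ hkl) _)
      (ae_of_all _ fun ω => ?_)
    exact ENNReal.Tendsto.const_mul (tendsto_expSlope _) (Or.inr (expNeg_ne_top _))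
  have m2 : Monotone fun k => ∫⁻ z, expNeg (h z) * expSlope k (g z) ∂Λ := fun k l hkl =>
    lintegral_mono fun z => mul_le_mul_right (expSlope_mono _ hkl) _
  -- Up to the factor 2^k, the left side is the difference of the Laplace functionals at h and at h
  -- + g/2^k. The exponents differ by an integral of exp(-h)(1 - exp(-g/2^k)), so an `expSlope`
  -- appears once inside and once outside.
  have key : ∀ k, ∫⁻ ω, expNeg (∑' j, h (X j ω)) * expSlope k (∑' j, g (X j ω)) ∂P =
      expNeg (∫⁻ z, (1 - expNeg (h z)) ∂Λ) *
        expSlope k (∫⁻ z, expNeg (h z) * expSlope k (g z) ∂Λ) := fun k => by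
    have c0 : (2 : ℝ≥0∞) ^ k ≠ 0 := by simp
    have ct : (2 : ℝ≥0∞) ^ k ≠ ∞ := by simp
    have mgk : Measurable fun z => g z / 2 ^ k := hg.div_const _
    have a1 : ∀ ω, expNeg (∑' j, h (X j ω)) * expSlope k (∑' j, g (X j ω)) =
        2 ^ k * (expNeg (∑' j, h (X j ω)) - expNeg (∑' j, (h (X j ω) + g (X j ω) / 2 ^ k))) :=
      fun ω => by
        rw [expSlope, ENNReal.tsum_add, expNeg_add, mul_left_comm, ENNReal.mul_sub
          (fun _ _ => expNeg_ne_top _), mul_one]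
        simp_rw [div_eq_mul_inv]
        rw [ENNReal.tsum_mul_right]
    have a2 : ∫⁻ z, (1 - expNeg (h z + g z / 2 ^ k)) ∂Λ =
        ∫⁻ z, (1 - expNeg (h z)) ∂Λ +
          (∫⁻ z, expNeg (h z) * expSlope k (g z) ∂Λ) / 2 ^ k := by
      have mhg : Measurable fun z => expNeg (h z) * expSlope k (g z) :=
        eh.mul ((continuous_expSlope k).measurable.comp hg)
      have meh : Measurable fun z => 1 - expNeg (h z) := measurable_const.sub eh
      rw [div_eq_mul_inv, ← lintegral_mul_const _ mhg, ← lintegral_add_left meh]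
      refine lintegral_congr fun z => ?_
      have : expNeg (h z) * expSlope k (g z) * (2 ^ k)⁻¹ =
          expNeg (h z) - expNeg (h z) * expNeg (g z / 2 ^ k) := by
        rw [expSlope, mul_left_comm, mul_comm (2 ^ k), mul_assoc, ENNReal.mul_inv_cancel c0 ct,
          mul_one, ENNReal.mul_sub (fun _ _ => expNeg_ne_top _), mul_one]
      rw [this, expNeg_add, tsub_add_tsub_cancel (expNeg_le_one _)]
      exact mul_le_of_le_one_right' (expNeg_le_one _)
    have a3 := hP.laplace hX (h := fun z => h z + g z / 2 ^ k) (hh.add mgk)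
    simp_rw [a1]
    rw [lintegral_const_mul' _ _ ct, lintegral_sub, hP.laplace hX hh,
      a3, a2, expNeg_add, expSlope, mul_left_comm (expNeg _),
      ENNReal.mul_sub (fun _ _ => expNeg_ne_top _), mul_one]
    · exact measurable_expNeg.comp (measurable_tsum_comp hX (hh.add mgk))
    · refine ne_top_of_le_ne_top ENNReal.one_ne_top ?_
      exact (lintegral_mono fun ω => expNeg_le_one _).trans (by simp)
    · exact ae_of_all _ fun ω => expNeg_antitone
        (ENNReal.tsum_le_tsum fun j => le_self_add)
  refine tendsto_nhds_unique l1 ?_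
  simp_rw [key]
  exact ENNReal.Tendsto.const_mul (tendsto_expSlope_of_monotone m2 l2)
    (Or.inr (expNeg_ne_top _))

lemma IsPoissonProcess.campbell [SigmaFinite Λ] (hX : ∀ j, Measurable (X j))
    (hP : IsPoissonProcess (fun ω => Measure.sum fun j => Measure.dirac (X j ω)) Λ P)
    {g : E → ℝ≥0∞} (hg : Measurable g) :
    ∫⁻ ω, ∑' j, g (X j ω) ∂P = ∫⁻ z, g z ∂Λ := by
  simpa using hP.lintegral_expNeg_mul_tsum hX (h := fun _ => 0) measurable_const hg

/-- The expected number of points violating `p` is, by Campbell's formula, the intensity of a null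
set. -/
lemma IsPoissonProcess.ae_all [SigmaFinite Λ] (hX : ∀ j, Measurable (X j))
    (hP : IsPoissonProcess (fun ω => Measure.sum fun j => Measure.dirac (X j ω)) Λ P)
    {p : E → Prop} (hp : MeasurableSet {z | p z}) (h : ∀ᵐ z ∂Λ, p z) :
    ∀ᵐ ω ∂P, ∀ j, p (X j ω) := by
  have hm : Measurable ({z | p z}ᶜ.indicator fun _ => (1 : ℝ≥0∞)) :=
    measurable_const.indicator hp.compl
  have h1 := hP.campbell hX hm
  rw [lintegral_indicator hp.compl, setLIntegral_one, show Λ {z | p z}ᶜ = 0 from h,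
    lintegral_eq_zero_iff (measurable_tsum_comp hX hm)] at h1
  filter_upwards [h1] with ω hω j
  have := ENNReal.tsum_eq_zero.1 hω j
  by_contra hj
  rw [Set.indicator_of_mem (show X j ω ∈ {z | p z}ᶜ from hj)] at this
  exact one_ne_zero this

/-- The reduced Mecke formula for exponential functionals. -/
lemma IsPoissonProcess.mecke_expNeg [SigmaFinite Λ] (hX : ∀ j, Measurable (X j))
    (hP : IsPoissonProcess (fun ω => Measure.sum fun j => Measure.dirac (X j ω)) Λ P)
    {h : E → ℝ≥0∞} (hh : Measurable h) (hfin : ∀ᵐ z ∂Λ, h z ≠ ∞) {C : Set E}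
    (hC : MeasurableSet C) :
    ∫⁻ ω, ∑' j, C.indicator (fun _ => expNeg (∑' i, if i = j then 0 else h (X i ω))) (X j ω) ∂P =
      Λ C * expNeg (∫⁻ z, (1 - expNeg (h z)) ∂Λ) := by
  have eh := measurable_expNeg.comp hh
  -- This weight cancels the factor exp(-h) of the distinguished point, so that the full sum becomes
  -- the sum over the other points. The cancellation requires `h` to be finite there, hence `hfin`.
  have hg : Measurable (C.indicator fun z => (expNeg (h z))⁻¹) := eh.inv.indicator hC
  have h1 := hP.lintegral_expNeg_mul_tsum hX hh hg
  have h2 : ∫⁻ z, expNeg (h z) * C.indicator (fun z => (expNeg (h z))⁻¹) z ∂Λ = Λ C := by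
    rw [← setLIntegral_one, ← lintegral_indicator hC]
    refine lintegral_congr_ae ?_
    filter_upwards [hfin] with z hz
    by_cases hzC : z ∈ C
    · simp only [Set.indicator_of_mem hzC]
      exact ENNReal.mul_inv_cancel (by rwa [Ne, expNeg_eq_zero]) (expNeg_ne_top _)
    · simp [hzC]
  rw [h2] at h1
  rw [mul_comm, ← h1]
  refine lintegral_congr_ae ?_
  have hms : MeasurableSet {z | h z ≠ ∞} := hh (measurableSet_singleton ∞).compl
  filter_upwards [hP.ae_all hX hms hfin] with ω hω
  rw [← ENNReal.tsum_mul_left]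
  refine tsum_congr fun j => ?_
  by_cases hj : X j ω ∈ C
  · simp only [Set.indicator_of_mem hj]
    rw [ENNReal.tsum_eq_add_tsum_ite j (f := fun i => h (X i ω)), expNeg_add, mul_comm, ← mul_assoc,
      ENNReal.inv_mul_cancel (by rw [Ne, expNeg_eq_zero]; exact hω j) (expNeg_ne_top _), one_mul]
    congr!
  · simp [hj]

end Poisson

/-! ### Mecke formula with an exponent depending on the distinguished point -/

section Mecke

variable {E Ω : Type*} [MeasurableSpace E] [MeasurableSpace Ω] {P : Measure Ω}
  {X : ℕ → Ω → E} {Λ : Measure E}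

lemma measurable_indicator_comp {Y : Ω → E} (hY : Measurable Y) {C : Set E}
    (hC : MeasurableSet C) {G : Ω → ℝ≥0∞} (hG : Measurable G) :
    Measurable fun ω => C.indicator (fun _ => G ω) (Y ω) :=
  hG.indicator (hY hC)

lemma measurable_tsum_ne (hX : ∀ j, Measurable (X j)) {h : E → ℝ≥0∞} (hh : Measurable h)
    (j : ℕ) : Measurable fun ω => ∑' i, if i = j then 0 else h (X i ω) :=
  Measurable.tsum fun i => by
    split_ifs
    · exact measurable_const
    · exact hh.comp (hX i)

variable [IsProbabilityMeasure P]

/-- On each level set of `d` the exponent is a fixed function, so the previous formula applies level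
by level. -/
lemma IsPoissonProcess.mecke_expNeg_nat [SigmaFinite Λ] (hX : ∀ j, Measurable (X j))
    (hP : IsPoissonProcess (fun ω => Measure.sum fun j => Measure.dirac (X j ω)) Λ P)
    {h : ℕ → E → ℝ≥0∞} (hh : ∀ n, Measurable (h n)) (hfin : ∀ n, ∀ᵐ z ∂Λ, h n z ≠ ∞)
    {C : Set E} (hC : MeasurableSet C) {d : E → ℕ} (hd : Measurable d) :
    ∫⁻ ω, ∑' j, C.indicator (fun x => expNeg (∑' i, if i = j then 0 else h (d x) (X i ω)))
        (X j ω) ∂P =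
      ∫⁻ x in C, expNeg (∫⁻ z, (1 - expNeg (h (d x) z)) ∂Λ) ∂Λ := by
  have hCn : ∀ n, MeasurableSet (C ∩ d ⁻¹' {n}) := fun n =>
    hC.inter (hd (measurableSet_singleton n))
  have split : ∀ (F : ℕ → ℝ≥0∞) (x : E), C.indicator (fun x => F (d x)) x =
      ∑' n, (C ∩ d ⁻¹' {n}).indicator (fun _ => F n) x := fun F x => by
    rw [tsum_eq_single (d x)]
    · by_cases hx : x ∈ C <;> simp [hx]
    · intro n hn
      refine Set.indicator_of_notMem (fun hx => hn ?_) _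
      exact hx.2.symm
  have hm : ∀ n j, Measurable fun ω => (C ∩ d ⁻¹' {n}).indicator
      (fun _ => expNeg (∑' i, if i = j then 0 else h n (X i ω))) (X j ω) := fun n j =>
    measurable_indicator_comp (hX j) (hCn n) (measurable_expNeg.comp
      (measurable_tsum_ne hX (hh n) j))
  have l1 : ∀ ω, ∑' j, C.indicator
      (fun x => expNeg (∑' i, if i = j then 0 else h (d x) (X i ω))) (X j ω) =
      ∑' n, ∑' j, (C ∩ d ⁻¹' {n}).indicator
      (fun _ => expNeg (∑' i, if i = j then 0 else h n (X i ω))) (X j ω) := fun ω => by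
    rw [ENNReal.tsum_comm]
    exact tsum_congr fun j =>
      split (fun n => expNeg (∑' i, if i = j then 0 else h n (X i ω))) (X j ω)
  simp_rw [l1]
  rw [lintegral_tsum fun n => (Measurable.tsum fun j => hm n j).aemeasurable,
    ← lintegral_indicator hC,
    lintegral_congr (split fun n => expNeg (∫⁻ z, (1 - expNeg (h n z)) ∂Λ)),
    lintegral_tsum fun n => (measurable_const.indicator (hCn n)).aemeasurable]
  refine tsum_congr fun n => ?_
  rw [hP.mecke_expNeg hX (hh n) (hfin n) (hCn n), lintegral_indicator_const (hCn n), mul_comm]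

/-- The reduced Mecke formula for exponential functionals whose exponent depends monotonically on
a nonnegative parameter of the distinguished point. -/
lemma IsPoissonProcess.mecke_expNeg_monotone [SigmaFinite Λ] (hX : ∀ j, Measurable (X j))
    (hP : IsPoissonProcess (fun ω => Measure.sum fun j => Measure.dirac (X j ω)) Λ P)
    {h : ℝ → E → ℝ≥0∞} (hh : ∀ r, Measurable (h r)) (hfin : ∀ r, 0 ≤ r → ∀ᵐ z ∂Λ, h r z ≠ ∞)
    (hmono : ∀ z, MonotoneOn (fun r => h r z) (Set.Ici 0))
    (hcont : ContinuousOn (fun r => expNeg (∫⁻ z, (1 - expNeg (h r z)) ∂Λ)) (Set.Ici 0))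
    {C : Set E} (hC : MeasurableSet C) (hCfin : Λ C ≠ ∞) {ρ : E → ℝ} (hρ : Measurable ρ)
    (hρ0 : ∀ x, 0 ≤ ρ x) :
    ∫⁻ ω, ∑' j, C.indicator (fun x => expNeg (∑' i, if i = j then 0 else h (ρ x) (X i ω)))
        (X j ω) ∂P =
      ∫⁻ x in C, expNeg (∫⁻ z, (1 - expNeg (h (ρ x) z)) ∂Λ) ∂Λ := by
  set G : ℝ → ℝ≥0∞ := fun r => expNeg (∫⁻ z, (1 - expNeg (h r z)) ∂Λ) with hG
  set L : (E → ℝ) → ℝ≥0∞ := fun d => ∫⁻ ω, ∑' j, C.indicator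
    (fun x => expNeg (∑' i, if i = j then 0 else h (d x) (X i ω))) (X j ω) ∂P with hL
  have hv0 : ∀ k n : ℕ, (0 : ℝ) ≤ n / (k + 1 : ℕ) := fun k n => by positivity
  have hLanti : ∀ d e : E → ℝ, (∀ x, 0 ≤ d x) → (∀ x, d x ≤ e x) → L e ≤ L d :=
    fun d e h0 hde => by
      refine lintegral_mono fun ω => ENNReal.tsum_le_tsum fun j => Set.indicator_le_indicator ?_
      refine expNeg_antitone (ENNReal.tsum_le_tsum fun i => ?_)
      split_ifs
      · exact le_rfl
      · exact hmono _ (h0 _) ((h0 _).trans (hde _)) (hde _)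
  have hLG : ∀ (k : ℕ) (d : E → ℕ), Measurable d →
      L (fun x => d x / (k + 1 : ℕ)) = ∫⁻ x in C, G (d x / (k + 1 : ℕ)) ∂Λ := fun k d hd =>
    hP.mecke_expNeg_nat hX (h := fun n => h (n / (k + 1 : ℕ))) (fun n => hh _)
      (fun n => hfin _ (hv0 k n)) hC hd
  have hlim : ∀ d : ℕ → E → ℕ, (∀ k, Measurable (d k)) →
      (∀ x, Tendsto (fun k => (d k x : ℝ) / (k + 1 : ℕ)) atTop (𝓝 (ρ x))) →
      Tendsto (fun k : ℕ => L (fun x => d k x / (k + 1 : ℕ))) atTop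
        (𝓝 (∫⁻ x in C, G (ρ x) ∂Λ)) := fun d hd hdl => by
    simp_rw [fun k => hLG k (d k) (hd k)]
    refine tendsto_lintegral_of_dominated_convergence (fun _ => 1)
      (fun k => (measurable_of_countable fun n : ℕ => G (n / (k + 1 : ℕ))).comp (hd k))
      (fun k => ae_of_all _ fun x => expNeg_le_one _) (by simpa using hCfin)
      (ae_of_all _ fun x => ?_)
    refine (hcont (ρ x) (hρ0 x)).tendsto.comp (tendsto_nhdsWithin_iff.2 ⟨hdl x, ?_⟩)
    exact Eventually.of_forall fun k => hv0 k _
  have hcast : Tendsto (fun k : ℕ => ((k + 1 : ℕ) : ℝ)) atTop atTop :=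
    tendsto_natCast_atTop_atTop.comp (tendsto_add_atTop_nat 1)
  have hk : ∀ k : ℕ, (0 : ℝ) < (k + 1 : ℕ) := fun k => by positivity
  -- Rounding the radius down to the grid of mesh 1/(k+1) raises the left side, rounding it up
  -- lowers it. Both discretised values converge to the right side by continuity and dominated
  -- convergence, for which `Λ C` must be finite.
  refine le_antisymm ?_ ?_
  · refine ge_of_tendsto' (hlim (fun k x => ⌊ρ x * (k + 1 : ℕ)⌋₊)
      (fun k => (hρ.mul_const _).nat_floor)
      (fun x => (tendsto_nat_floor_mul_div_atTop (hρ0 x)).comp hcast)) fun k => ?_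
    refine hLanti _ _ (fun x => hv0 k _) fun x => ?_
    rw [div_le_iff₀ (hk k)]
    exact Nat.floor_le (mul_nonneg (hρ0 x) (hk k).le)
  · refine le_of_tendsto' (hlim (fun k x => ⌈ρ x * (k + 1 : ℕ)⌉₊)
      (fun k => (hρ.mul_const _).nat_ceil)
      (fun x => (tendsto_nat_ceil_mul_div_atTop (hρ0 x)).comp hcast)) fun k => ?_
    refine hLanti _ _ hρ0 fun x => ?_
    rw [le_div_iff₀ (hk k)]
    exact Nat.le_ceil _

end Mecke

/-! ### Exponential law: Laplace transform and tail -/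

lemma lintegral_expMeasure_one {f : ℝ → ℝ≥0∞} (hf : Measurable f) :
    ∫⁻ x, f x ∂(expMeasure 1) = ∫⁻ x in Set.Ioi 0, ENNReal.ofReal (Real.exp (-x)) * f x := by
  have hm : Measurable (gammaPDF 1 1) := (measurable_gammaPDFReal 1 1).ennreal_ofReal
  rw [expMeasure, gammaMeasure, lintegral_withDensity_eq_lintegral_mul _ hm hf,
    ← setLIntegral_congr Ioi_ae_eq_Ici.symm, ← lintegral_indicator measurableSet_Ici]
  refine lintegral_congr fun x => ?_
  by_cases hx : 0 ≤ x
  · rw [Set.indicator_of_mem (show x ∈ Set.Ici 0 from hx), Pi.mul_apply, gammaPDF_of_nonneg hx]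
    simp
  · rw [Set.indicator_of_notMem (by simpa using hx), Pi.mul_apply,
      gammaPDF_of_neg (not_le.1 hx), zero_mul]

lemma ae_expMeasure_one_pos : ∀ᵐ x ∂(expMeasure 1), 0 < x := by
  have hm : Measurable ((Set.Ioi (0 : ℝ))ᶜ.indicator fun _ => (1 : ℝ≥0∞)) :=
    measurable_const.indicator measurableSet_Ioi.compl
  have h := lintegral_expMeasure_one hm
  rw [lintegral_indicator measurableSet_Ioi.compl, setLIntegral_one,
    setLIntegral_congr_fun (g := fun _ => 0) measurableSet_Ioi fun x hx => by simp_all] at h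
  rw [ae_iff]
  simpa [Set.Iic_def] using h

lemma lintegral_Ioi_exp_neg (t : ℝ) :
    ∫⁻ x in Set.Ioi t, ENNReal.ofReal (Real.exp (-x)) = ENNReal.ofReal (Real.exp (-t)) := by
  rw [← ofReal_integral_eq_lintegral_ofReal (integrableOn_exp_neg_Ioi t)
    (ae_of_all _ fun x => (Real.exp_pos _).le), integral_exp_neg_Ioi]

/-- The Laplace transform of the exponential distribution. -/
lemma lintegral_expNeg_expMeasure (a : ℝ≥0∞) :
    ∫⁻ x, expNeg (a * ENNReal.ofReal x) ∂(expMeasure 1) = (1 + a)⁻¹ := by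
  have hm : Measurable fun x => expNeg (a * ENNReal.ofReal x) :=
    measurable_expNeg.comp (measurable_const.mul ENNReal.measurable_ofReal)
  by_cases ha : a = ∞
  · subst ha
    -- Since ∞ · 0 = 0, the case a = ∞ uses that the variable is almost surely positive.
    rw [lintegral_congr_ae (g := fun _ => 0)]
    · simp
    · filter_upwards [ae_expMeasure_one_pos] with x hx
      rw [ENNReal.top_mul (by simpa using hx), expNeg_top]
  · lift a to ℝ≥0 using ha
    rw [lintegral_expMeasure_one hm]
    have h1 : ∀ x ∈ Set.Ioi (0 : ℝ), ENNReal.ofReal (Real.exp (-x)) *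
        expNeg (a * ENNReal.ofReal x) = ENNReal.ofReal (Real.exp (-(1 + a) * x)) := fun x hx => by
      rw [← ENNReal.ofReal_coe_nnreal, ← ENNReal.ofReal_mul a.coe_nonneg,
        expNeg_ofReal (mul_nonneg a.coe_nonneg (le_of_lt hx)),
        ← ENNReal.ofReal_mul (Real.exp_pos _).le, ← Real.exp_add]
      congr 2
      ring
    have hneg : -(1 + (a : ℝ)) < 0 := by have := a.coe_nonneg; linarith
    rw [setLIntegral_congr_fun measurableSet_Ioi h1,
      ← ofReal_integral_eq_lintegral_ofReal (integrableOn_exp_mul_Ioi hneg 0)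
      (ae_of_all _ fun x => (Real.exp_pos _).le), integral_exp_mul_Ioi hneg]
    simp only [mul_zero, Real.exp_zero]
    rw [neg_div_neg_eq, one_div, ENNReal.ofReal_inv_of_pos (by positivity),
      ENNReal.ofReal_add zero_le_one a.coe_nonneg]
    simp

/-- The tail of the exponential distribution. -/
lemma expMeasure_le_ofReal (c : ℝ≥0∞) :
    (expMeasure 1) {x | c ≤ ENNReal.ofReal x} = expNeg c := by
  have hms : MeasurableSet {x : ℝ | c ≤ ENNReal.ofReal x} :=
    ENNReal.measurable_ofReal measurableSet_Ici
  by_cases hc : c = ∞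
  · subst hc
    simp
  · rw [← setLIntegral_one, ← lintegral_indicator hms,
      lintegral_expMeasure_one (measurable_const.indicator hms)]
    have h1 : ∀ x ∈ Set.Ioi (0 : ℝ), ENNReal.ofReal (Real.exp (-x)) *
        ({x : ℝ | c ≤ ENNReal.ofReal x}.indicator (fun _ => 1) x) =
        (Set.Ici c.toReal).indicator (fun x => ENNReal.ofReal (Real.exp (-x))) x := fun x hx => by
      have : c ≤ ENNReal.ofReal x ↔ c.toReal ≤ x := ENNReal.le_ofReal_iff_toReal_le hc (le_of_lt hx)
      by_cases h : c.toReal ≤ x <;> simp [Set.indicator, this, h]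
    rw [setLIntegral_congr_fun measurableSet_Ioi h1, lintegral_indicator measurableSet_Ici,
      Measure.restrict_restrict measurableSet_Ici]
    have h2 : (Set.Ici c.toReal ∩ Set.Ioi 0 : Set ℝ) =ᵐ[volume] Set.Ioi c.toReal := by
      have : (Set.Ici c.toReal ∩ Set.Ici 0 : Set ℝ) = Set.Ici c.toReal :=
        Set.inter_eq_left.2 (Set.Ici_subset_Ici.2 ENNReal.toReal_nonneg)
      refine ((ae_eq_refl _).inter Ioi_ae_eq_Ici).trans ?_
      rw [this]
      exact Ioi_ae_eq_Ici.symm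
    rw [setLIntegral_congr h2, lintegral_Ioi_exp_neg, ← expNeg_ofReal ENNReal.toReal_nonneg,
      ENNReal.ofReal_toReal hc]

/-- Independence of the blocks of an independent family with two indices. -/
lemma iIndepFun_curry {Ω ι κ X : Type*} [MeasurableSpace Ω] [MeasurableSpace X] {P : Measure Ω}
    [IsProbabilityMeasure P] {F : ι → κ → Ω → X} (hF : ∀ i j, Measurable (F i j))
    (h : iIndepFun (fun p : ι × κ => F p.1 p.2) P) :
    iIndepFun (fun i ω j => F i j ω) P := by
  have hp : ∀ i j, IsProbabilityMeasure (P.map (F i j)) := fun i j =>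
    Measure.isProbabilityMeasure_map (hF i j).aemeasurable
  have hb : ∀ i, P.map (fun ω j => F i j ω) = Measure.infinitePi fun j => P.map (F i j) :=
    fun i => (h.precomp (Prod.mk_right_injective i)).map_fun_eq_infinitePi_map fun j => hF i j
  rw [iIndepFun_iff_map_fun_eq_infinitePi_map fun i => measurable_pi_iff.2 fun j => hF i j]
  simp_rw [hb]
  -- Independence is the statement that the joint law is a product measure, and currying a product
  -- over pairs gives a product of products.
  rw [← Measure.infinitePi_map_curry]
  have hj : P.map (fun ω (p : ι × κ) => F p.1 p.2 ω) =
      Measure.infinitePi fun p : ι × κ => P.map (F p.1 p.2) :=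
    h.map_fun_eq_infinitePi_map fun p => hF p.1 p.2
  have hm : Measurable fun ω (p : ι × κ) => F p.1 p.2 ω :=
    measurable_pi_iff.2 fun p => hF p.1 p.2
  rw [← hj, Measure.map_map (MeasurableEquiv.measurable _) hm]
  rfl

/-! ### One exponential variable against a weighted sum -/

section Fading

variable {Ω : Type*} [MeasurableSpace Ω] {P : Measure Ω} [IsProbabilityMeasure P]

/-- Condition on `S` and use the exponential tail P(G ≥ c) = exp(-c); this is where Rayleigh fading
turns a success probability into a Laplace transform. -/
lemma measure_le_ofReal_of_indepFun {S : Ω → ℝ≥0∞} {G : Ω → ℝ} (hS : Measurable S)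
    (hG : Measurable G) (hlaw : HasLaw G (expMeasure 1) P)
    (h : IndepFun S (fun ω => ENNReal.ofReal (G ω)) P) :
    P {ω | S ω ≤ ENNReal.ofReal (G ω)} = ∫⁻ ω, expNeg (S ω) ∂P := by
  have hms : MeasurableSet {p : ℝ≥0∞ × ℝ≥0∞ | p.1 ≤ p.2} :=
    measurableSet_le measurable_fst measurable_snd
  have hGo : Measurable fun ω => ENNReal.ofReal (G ω) := hG.ennreal_ofReal
  have hprob : IsProbabilityMeasure (P.map fun ω => ENNReal.ofReal (G ω)) :=
    Measure.isProbabilityMeasure_map hGo.aemeasurable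
  have h1 : P {ω | S ω ≤ ENNReal.ofReal (G ω)} =
      P.map (fun ω => (S ω, ENNReal.ofReal (G ω))) {p | p.1 ≤ p.2} := by
    rw [Measure.map_apply (hS.prodMk hGo) hms]
    rfl
  rw [h1, (indepFun_iff_map_prod_eq_prod_map_map hS.aemeasurable hGo.aemeasurable).1 h,
    Measure.prod_apply hms, lintegral_map (measurable_measure_prodMk_left hms) hS]
  refine lintegral_congr fun ω => ?_
  rw [Measure.map_apply hGo (measurable_prodMk_left hms), ← expMeasure_le_ofReal (S ω),
    ← hlaw.map_eq, Measure.map_apply hG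
    (show MeasurableSet {x : ℝ | S ω ≤ ENNReal.ofReal x} from
      ENNReal.measurable_ofReal measurableSet_Ici)]
  rfl

/-- The probability that an exponential variable dominates a weighted sum of independent ones. -/
lemma measure_tsum_le_ofReal {G : ℕ → Ω → ℝ} (hG : ∀ i, Measurable (G i))
    (hlaw : ∀ i, HasLaw (G i) (expMeasure 1) P) (hind : iIndepFun G P) (a : ℕ → ℝ≥0∞) {j : ℕ}
    (ha : a j = 0) :
    P {ω | ∑' i, a i * ENNReal.ofReal (G i ω) ≤ ENNReal.ofReal (G j ω)} =
      expNeg (∑' i, negLog (1 + a i)⁻¹) := by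
  classical
  have hGo : ∀ i, Measurable fun ω => ENNReal.ofReal (G i ω) := fun i => (hG i).ennreal_ofReal
  have hsm : ∀ n, Measurable fun ω => ∑ i ∈ Finset.range n, a i * ENNReal.ofReal (G i ω) :=
    fun n => Finset.measurable_fun_sum _ fun i _ => (hGo i).const_mul _
  have hms : ∀ n, MeasurableSet
      {ω | ∑ i ∈ Finset.range n, a i * ENNReal.ofReal (G i ω) ≤ ENNReal.ofReal (G j ω)} :=
    fun n => measurableSet_le (hsm n) (hGo j)
  have hfinite : ∀ n, P {ω | ∑ i ∈ Finset.range n, a i * ENNReal.ofReal (G i ω) ≤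
      ENNReal.ofReal (G j ω)} = expNeg (∑ i ∈ Finset.range n, negLog (1 + a i)⁻¹) := fun n => by
    -- Coefficient 1 at `j` puts the variable of the signal itself into the family, while the sum
    -- runs over indices other than `j`; since `a j = 0`, omitting `j` does not change the sum.
    have hind' : iIndepFun (fun i ω => (if i = j then 1 else a i) * ENNReal.ofReal (G i ω)) P :=
      hind.comp (fun i x => (if i = j then 1 else a i) * ENNReal.ofReal x)
        fun i => ENNReal.measurable_ofReal.const_mul _
    have h1 := hind'.indepFun_finsetSum_of_notMem (fun i => (hGo i).const_mul _)
      (Finset.notMem_erase j (Finset.range n))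
    have h2 : (∑ i ∈ (Finset.range n).erase j,
        fun ω => (if i = j then 1 else a i) * ENNReal.ofReal (G i ω)) =
        fun ω => ∑ i ∈ Finset.range n, a i * ENNReal.ofReal (G i ω) := by
      ext ω
      rw [Finset.sum_apply, ← Finset.sum_erase (s := Finset.range n) (a := j) (by simp [ha])]
      refine Finset.sum_congr rfl fun i hi => ?_
      rw [if_neg (Finset.ne_of_mem_erase hi)]
    rw [h2] at h1
    simp only [if_true, one_mul] at h1
    rw [measure_le_ofReal_of_indepFun (hsm n) (hG j) (hlaw j) h1]
    simp_rw [expNeg_sum]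
    have hind2 : iIndepFun (fun i ω => expNeg (a i * ENNReal.ofReal (G i ω))) P :=
      hind.comp (fun i x => expNeg (a i * ENNReal.ofReal x))
        fun i => measurable_expNeg.comp (ENNReal.measurable_ofReal.const_mul _)
    rw [lintegral_prod_eq_prod_lintegral_of_indepFun _ _ hind2
      fun i => measurable_expNeg.comp ((hGo i).const_mul _)]
    refine Finset.prod_congr rfl fun i _ => ?_
    have hm : Measurable fun x => expNeg (a i * ENNReal.ofReal x) :=
      measurable_expNeg.comp (ENNReal.measurable_ofReal.const_mul _)
    rw [expNeg_negLog (by simp), ← lintegral_expNeg_expMeasure, ← (hlaw i).map_eq,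
      lintegral_map hm (hG i)]
  have hanti : Antitone fun n =>
      {ω | ∑ i ∈ Finset.range n, a i * ENNReal.ofReal (G i ω) ≤ ENNReal.ofReal (G j ω)} :=
    fun m n hmn ω hω => Set.mem_ofPred.2 <|
      le_trans (Finset.sum_le_sum_of_subset (Finset.range_mono hmn)) hω
  have hInter : {ω | ∑' i, a i * ENNReal.ofReal (G i ω) ≤ ENNReal.ofReal (G j ω)} =
      ⋂ n, {ω | ∑ i ∈ Finset.range n, a i * ENNReal.ofReal (G i ω) ≤
        ENNReal.ofReal (G j ω)} := by
    ext ω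
    simp only [Set.mem_ofPred_eq, Set.mem_iInter]
    exact ⟨fun h n => (ENNReal.sum_le_tsum _).trans h,
      fun h => le_of_tendsto' (ENNReal.tendsto_nat_tsum _) h⟩
  rw [hInter]
  refine tendsto_nhds_unique (tendsto_measure_iInter_atTop (fun n => (hms n).nullMeasurableSet)
    hanti ⟨0, measure_ne_top _ _⟩) ?_
  simp_rw [Function.comp_def, hfinite]
  exact (continuous_expNeg.tendsto _).comp (ENNReal.tendsto_nat_tsum _)

end Fading

/-! ### Success and coverage probabilities for fixed positions -/

/-- The signal to interference ratio of the link from the `j`-th transmitter to a receiver at `y`,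
for transmitters at `x` and fading variables `f`. -/
noncomputable def sirAt (ℓ : ℝ → ℝ) (j : ℕ) (f : ℕ → ℝ) (x : ℕ → Plane) (y : Plane) : ℝ≥0∞ :=
  ENNReal.ofReal (f j) / ENNReal.ofReal (ℓ (dist (x j) y)) /
    (ENNReal.ofReal 0 +
      ∑' i : ℕ, if i = j then 0 else ENNReal.ofReal (f i) / ENNReal.ofReal (ℓ (dist (x i) y)))

/-- Minus the logarithm of the Laplace transform, at the threshold, of the contribution to the
interference of a transmitter at distance `s`, for a link of length `r`. -/
noncomputable def interferenceExponent (ℓ : ℝ → ℝ) (T r s : ℝ) : ℝ≥0∞ :=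
  negLog (1 + ENNReal.ofReal T * ENNReal.ofReal (ℓ r) / ENNReal.ofReal (ℓ s))⁻¹

/-- The probability that a single transmission succeeds, given the positions. -/
noncomputable def successProb (ℓ : ℝ → ℝ) (T : ℝ) (j : ℕ) (x : ℕ → Plane) (y : Plane) : ℝ≥0∞ :=
  expNeg (∑' i, if i = j then 0 else interferenceExponent ℓ T (dist (x j) y) (dist (x i) y))

lemma measurable_sirAt {E : Type*} [MeasurableSpace E] {ℓ : ℝ → ℝ} (hℓ : Measurable ℓ) (j : ℕ)
    {f : E → ℕ → ℝ} {x : E → ℕ → Plane} {y : E → Plane} (hf : ∀ i, Measurable fun e => f e i)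
    (hx : ∀ i, Measurable fun e => x e i) (hy : Measurable y) :
    Measurable fun e => sirAt ℓ j (f e) (x e) (y e) := by
  have hp : ∀ i, Measurable fun e =>
      ENNReal.ofReal (f e i) / ENNReal.ofReal (ℓ (dist (x e i) (y e))) := fun i =>
    (hf i).ennreal_ofReal.div (hℓ.comp ((hx i).dist hy)).ennreal_ofReal
  have hs : Measurable fun e => ∑' i : ℕ,
      if i = j then 0 else ENNReal.ofReal (f e i) / ENNReal.ofReal (ℓ (dist (x e i) (y e))) :=
    Measurable.tsum fun i => by
      split_ifs
      · exact measurable_const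
      · exact hp i
  simp only [sirAt]
  exact (hp j).div (hs.const_add _)

lemma measurable_interferenceExponent {E : Type*} [MeasurableSpace E] {ℓ : ℝ → ℝ}
    (hℓ : Measurable ℓ) (T : ℝ) {r s : E → ℝ} (hr : Measurable r) (hs : Measurable s) :
    Measurable fun x => interferenceExponent ℓ T (r x) (s x) :=
  measurable_negLog.comp ((measurable_const.add ((measurable_const.mul
    (hℓ.comp hr).ennreal_ofReal).div (hℓ.comp hs).ennreal_ofReal)).inv)

lemma measurable_successProb {E : Type*} [MeasurableSpace E] {ℓ : ℝ → ℝ} (hℓ : Measurable ℓ)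
    (T : ℝ) (j : ℕ) {x : E → ℕ → Plane} {y : E → Plane} (hx : ∀ i, Measurable fun e => x e i)
    (hy : Measurable y) : Measurable fun e => successProb ℓ T j (x e) (y e) := by
  have hs : Measurable fun e => ∑' i : ℕ,
      if i = j then 0 else interferenceExponent ℓ T (dist (x e j) (y e)) (dist (x e i) (y e)) :=
    Measurable.tsum fun i => by
      split_ifs
      · exact measurable_const
      · exact measurable_interferenceExponent hℓ T ((hx j).dist hy) ((hx i).dist hy)
  simp only [successProb]
  exact measurable_expNeg.comp hs

lemma successProb_le_one (ℓ : ℝ → ℝ) (T : ℝ) (j : ℕ) (x : ℕ → Plane) (y : Plane) :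
    successProb ℓ T j x y ≤ 1 := expNeg_le_one _

section Fading

variable {Ω : Type*} [MeasurableSpace Ω] {P : Measure Ω} [IsProbabilityMeasure P]

lemma measure_le_sirAt {G : ℕ → Ω → ℝ} (hG : ∀ i, Measurable (G i))
    (hlaw : ∀ i, HasLaw (G i) (expMeasure 1) P) (hind : iIndepFun G P) {ℓ : ℝ → ℝ} {T : ℝ}
    {j : ℕ} {x : ℕ → Plane} {y : Plane} (hpos : 0 < ℓ (dist (x j) y)) :
    P {ω | ENNReal.ofReal T ≤ sirAt ℓ j (fun i => G i ω) x y} = successProb ℓ T j x y := by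
  set b : ℕ → ℝ≥0∞ := fun i => ENNReal.ofReal (ℓ (dist (x i) y)) with hb
  have hb0 : b j ≠ 0 := by simpa [hb] using hpos
  have hbt : b j ≠ ∞ := ENNReal.ofReal_ne_top
  set a : ℕ → ℝ≥0∞ := fun i => if i = j then 0 else ENNReal.ofReal T * b j / b i with ha
  have h1 := measure_tsum_le_ofReal hG hlaw hind a (j := j) (by simp [ha])
  have h2 : expNeg (∑' i, negLog (1 + a i)⁻¹) = successProb ℓ T j x y := by
    unfold successProb
    congr 1
    refine tsum_congr fun i => ?_
    by_cases hi : i = j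
    · simp [ha, hi]
    · simp only [ha, if_neg hi]
      rfl
  rw [← h2, ← h1]
  refine measure_congr ?_
  have hpos : ∀ᵐ ω ∂P, 0 < G j ω :=
    ((hlaw j).ae_iff (measurableSet_setOfPred.1 measurableSet_Ioi)).2 ae_expMeasure_one_pos
  filter_upwards [hpos] with ω hω
  refine propext ?_
  change ENNReal.ofReal T ≤ sirAt ℓ j (fun i => G i ω) x y ↔
    ∑' i, a i * ENNReal.ofReal (G i ω) ≤ ENNReal.ofReal (G j ω)
  -- The interference may be 0 or ∞, so clearing the denominator is justified by the signal being
  -- nonzero and finite instead.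
  have hF0 : ENNReal.ofReal (G j ω) / b j ≠ 0 := by
    simp [ENNReal.div_eq_zero_iff, hbt, hω]
  have hFt : ENNReal.ofReal (G j ω) / b j ≠ ∞ := by
    simp [ENNReal.div_eq_top, hb0, hbt]
  unfold sirAt
  rw [ENNReal.ofReal_zero, zero_add, ENNReal.le_div_iff_mul_le (Or.inr hF0) (Or.inr hFt),
    ENNReal.le_div_iff_mul_le (Or.inl hb0) (Or.inl hbt), mul_right_comm, ← ENNReal.tsum_mul_left]
  have : ∀ i, ENNReal.ofReal T * b j *
      (if i = j then 0 else ENNReal.ofReal (G i ω) / ENNReal.ofReal (ℓ (dist (x i) y))) =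
      a i * ENNReal.ofReal (G i ω) := fun i => by
    by_cases hi : i = j
    · simp [ha, hi]
    · simp only [ha, if_neg hi, div_eq_mul_inv]
      ring
  simp_rw [this]

/-- For fixed positions the SIRs at different times are functions of disjoint blocks of fading
variables, so the τ failures are independent with the same probability. -/
lemma measure_exists_le_sirAt {F : ℕ → ℕ → Ω → ℝ} (hF : ∀ n i, Measurable (F n i))
    (hlaw : ∀ n i, HasLaw (F n i) (expMeasure 1) P)
    (hind : iIndepFun (fun p : ℕ × ℕ => F p.1 p.2) P) {ℓ : ℝ → ℝ} (hℓ : Measurable ℓ) {T : ℝ}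
    (τ : ℕ) {j : ℕ} {x : ℕ → Plane} {y : Plane} (hpos : 0 < ℓ (dist (x j) y)) :
    P {ω | ∃ n ∈ Finset.Icc 1 τ, ENNReal.ofReal T ≤ sirAt ℓ j (fun i => F n i ω) x y} =
      1 - (1 - successProb ℓ T j x y) ^ τ := by
  have hm : Measurable fun f : ℕ → ℝ => sirAt ℓ j f x y :=
    measurable_sirAt hℓ j measurable_pi_apply (fun _ => measurable_const) measurable_const
  have hmF : ∀ n, Measurable fun ω => sirAt ℓ j (fun i => F n i ω) x y := fun n =>
    measurable_sirAt hℓ j (hF n) (fun _ => measurable_const) measurable_const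
  have hms : ∀ n, MeasurableSet {ω | ENNReal.ofReal T ≤ sirAt ℓ j (fun i => F n i ω) x y} :=
    fun n => measurableSet_le measurable_const (hmF n)
  have hI : iIndepFun (fun n ω => sirAt ℓ j (fun i => F n i ω) x y) P :=
    (iIndepFun_curry hF hind).comp (fun _ f => sirAt ℓ j f x y) fun _ => hm
  have hc : {ω | ∃ n ∈ Finset.Icc 1 τ, ENNReal.ofReal T ≤ sirAt ℓ j (fun i => F n i ω) x y}ᶜ =
      ⋂ n ∈ Finset.Icc 1 τ,
        (fun ω => sirAt ℓ j (fun i => F n i ω) x y) ⁻¹' Set.Iio (ENNReal.ofReal T) := by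
    ext ω
    simp
  have hmeas : MeasurableSet
      {ω | ∃ n ∈ Finset.Icc 1 τ, ENNReal.ofReal T ≤ sirAt ℓ j (fun i => F n i ω) x y} := by
    rw [← MeasurableSet.compl_iff, hc]
    exact Finset.measurableSet_biInter _ fun n _ => hmF n measurableSet_Iio
  have h1 := prob_compl_eq_one_sub (μ := P) hmeas.compl
  rw [compl_compl, hc, hI.measure_inter_preimage_eq_mul _ fun n _ => measurableSet_Iio] at h1
  rw [h1]
  congr 1
  have h2 : ∀ n ∈ Finset.Icc 1 τ,
      P ((fun ω => sirAt ℓ j (fun i => F n i ω) x y) ⁻¹' Set.Iio (ENNReal.ofReal T)) =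
        1 - successProb ℓ T j x y := fun n _ => by
    rw [← measure_le_sirAt (hF n) (hlaw n)
      (hind.precomp (g := fun i => (n, i)) (Prod.mk_right_injective n)) hpos,
      ← prob_compl_eq_one_sub (hms n)]
    congr 1
    ext ω
    simp
  rw [Finset.prod_congr rfl h2]
  simp

lemma measure_eq_lintegral_of_indepFun {E E' : Type*} [MeasurableSpace E] [MeasurableSpace E']
    {X : Ω → E} {Y : Ω → E'} (hX : Measurable X) (hY : Measurable Y) (h : IndepFun X Y P)
    {S : Set (E × E')} (hS : MeasurableSet S) :
    P {ω | (X ω, Y ω) ∈ S} = ∫⁻ ω, P {ω' | (X ω', Y ω) ∈ S} ∂P := by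
  have hprob : IsProbabilityMeasure (P.map X) := Measure.isProbabilityMeasure_map hX.aemeasurable
  have hprob' : IsProbabilityMeasure (P.map Y) := Measure.isProbabilityMeasure_map hY.aemeasurable
  have h1 : P {ω | (X ω, Y ω) ∈ S} = P.map (fun ω => (X ω, Y ω)) S := by
    rw [Measure.map_apply (hX.prodMk hY) hS]
    rfl
  rw [h1, (indepFun_iff_map_prod_eq_prod_map_map hX.aemeasurable hY.aemeasurable).1 h,
    Measure.prod_apply_symm hS, lintegral_map (measurable_measure_prodMk_right hS) hY]
  refine lintegral_congr fun ω => ?_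
  rw [Measure.map_apply hX (measurable_prodMk_right hS)]
  rfl

end Fading

/-! ### Integrating out the clusters -/

/-- The sum of a function over the receivers of a cluster. -/
lemma measurable_sum_cluster {E : Type*} [MeasurableSpace E] {g : E × Plane → ℝ≥0∞}
    (hg : Measurable g) :
    Measurable fun p : E × Cluster => ∑ k ∈ Finset.range p.2.1, g (p.1, p.2.2 k) := by
  have h : ∀ p : E × Cluster, ∑ k ∈ Finset.range p.2.1, g (p.1, p.2.2 k) =
      ∑' k, {q : E × Cluster | k < q.2.1}.indicator (fun q => g (q.1, q.2.2 k)) p := fun p => by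
    rw [tsum_eq_sum (s := Finset.range p.2.1)]
    · refine Finset.sum_congr rfl fun k hk => ?_
      rw [Set.indicator_of_mem (by simpa using hk)]
    · intro k hk
      exact Set.indicator_of_notMem (by simpa using hk) _
  simp_rw [h]
  refine Measurable.tsum fun k => Measurable.indicator ?_ ?_
  · exact hg.comp (measurable_fst.prodMk
      ((measurable_pi_apply k).comp (measurable_snd.comp measurable_snd)))
  · exact (measurable_fst.comp measurable_snd) measurableSet_Ioi

namespace Network

variable {Ω : Type*} [MeasurableSpace Ω] {P : Measure Ω} {lamM lamR R : ℝ}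
  (N : Network Ω P lamM lamR R)

lemma measurable_tx : Measurable fun ω j => N.tx j ω := measurable_pi_iff.2 N.tx_measurable

/-- Campbell's formula for one cluster: averaging its counting measure over `clusterLaw` gives the
intensity measure, so the identity for sets extends to functions. -/
lemma lintegral_clusterLaw (x : Plane) {g : Plane → ℝ≥0∞} (hg : Measurable g) :
    ∫⁻ c, ∑ k ∈ Finset.range c.1, g (c.2 k) ∂(N.clusterLaw x) =
      ENNReal.ofReal lamR * ∫⁻ y in Metric.ball x R, g y := by
  have hsum : ∀ f : Plane → ℝ≥0∞, Measurable f →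
      Measurable fun c : Cluster => ∑ k ∈ Finset.range c.1, f (c.2 k) := fun f hf =>
    (measurable_sum_cluster (E := Unit) (hf.comp measurable_snd)).comp
      (measurable_const.prodMk measurable_id : Measurable fun c : Cluster => ((), c))
  let D : Cluster → Measure Plane := fun c => ∑ k ∈ Finset.range c.1, Measure.dirac (c.2 k)
  have hDapply : ∀ c s, MeasurableSet s → D c s = Cluster.count c s := fun c s hs => by
    simp only [D, Cluster.count, Measure.coe_finsetSum, Finset.sum_apply]
    exact Finset.sum_congr rfl fun k _ => Measure.dirac_apply' _ hs
  have hD : Measurable D := by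
    refine Measure.measurable_of_measurable_coe _ fun s hs => ?_
    simp_rw [fun c => hDapply c s hs]
    exact hsum _ (measurable_const.indicator hs)
  have hbind : (N.clusterLaw x).bind D =
      ENNReal.ofReal lamR • volume.restrict (Metric.ball x R) := by
    ext s hs
    rw [Measure.bind_apply hs hD.aemeasurable]
    simp_rw [fun c => hDapply c s hs]
    rw [N.clusterLaw_intensity x s hs, Measure.smul_apply, Measure.restrict_apply hs, smul_eq_mul]
  have h1 := Measure.lintegral_bind (m := N.clusterLaw x) (f := g) hD.aemeasurable
    hg.aemeasurable
  rw [hbind, lintegral_smul_measure, smul_eq_mul] at h1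
  rw [h1]
  refine lintegral_congr fun c => ?_
  simp [D, lintegral_dirac' _ hg]

/-- The joint law of all transmitters and the `j`-th cluster is a composition product; on rectangles
this is the independent-marks property with the single index `j`. -/
lemma lintegral_tx_cluster [IsProbabilityMeasure P] (j : ℕ)
    {G : (ℕ → Plane) × Cluster → ℝ≥0∞} (hG : Measurable G) :
    ∫⁻ ω, G (fun i => N.tx i ω, N.cluster j ω) ∂P =
      ∫⁻ ω, ∫⁻ c, G (fun i => N.tx i ω, c) ∂(N.clusterLaw (N.tx j ω)) ∂P := by
  have := N.clusterLaw_markov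
  let κ : Kernel (ℕ → Plane) Cluster :=
    N.clusterLaw.comap (fun x => x j) (measurable_pi_apply j)
  have hκ : IsMarkovKernel κ := inferInstance
  have hprob : IsProbabilityMeasure (P.map fun ω i => N.tx i ω) :=
    Measure.isProbabilityMeasure_map N.measurable_tx.aemeasurable
  have hpair : Measurable fun ω => ((fun i => N.tx i ω), N.cluster j ω) :=
    N.measurable_tx.prodMk (N.cluster_measurable j)
  have hprob' : IsProbabilityMeasure (P.map fun ω => ((fun i => N.tx i ω), N.cluster j ω)) :=
    Measure.isProbabilityMeasure_map hpair.aemeasurable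
  have hmap : P.map (fun ω => ((fun i => N.tx i ω), N.cluster j ω)) =
      (P.map fun ω i => N.tx i ω) ⊗ₘ κ := by
    refine Measure.ext_prod fun {S C} hS hC => ?_
    rw [Measure.map_apply hpair (hS.prod hC), Measure.compProd_apply_prod hS hC,
      setLIntegral_map hS (κ.measurable_coe hC) N.measurable_tx]
    have := N.cluster_indep_marks S {j} (fun _ => C) hS fun _ => hC
    simp only [Finset.mem_singleton, forall_eq, Finset.prod_singleton] at this
    exact this
  rw [← lintegral_map hG hpair, hmap, Measure.lintegral_compProd hG,
    lintegral_map hG.lintegral_kernel_prod_right' N.measurable_tx]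
  rfl

end Network

/-! ### Expected number of covered receivers as an integral over links -/

/-- The probability that at least one of `τ` transmissions succeeds, given the positions. -/
noncomputable def coverProb (ℓ : ℝ → ℝ) (T : ℝ) (τ j : ℕ) (x : ℕ → Plane) (y : Plane) : ℝ≥0∞ :=
  1 - (1 - successProb ℓ T j x y) ^ τ

lemma measurable_coverProb {E : Type*} [MeasurableSpace E] {ℓ : ℝ → ℝ} (hℓ : Measurable ℓ)
    (T : ℝ) (τ j : ℕ) {x : E → ℕ → Plane} {y : E → Plane} (hx : ∀ i, Measurable fun e => x e i)
    (hy : Measurable y) : Measurable fun e => coverProb ℓ T τ j (x e) (y e) := by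
  simp only [coverProb]
  exact ((measurable_successProb hℓ T j hx hy).const_sub 1).pow_const τ |>.const_sub 1

namespace Network

variable {Ω : Type*} [MeasurableSpace Ω] {P : Measure Ω}
  {lamM lamR R : ℝ}
  (N : Network Ω P lamM lamR R)

lemma measurable_sum_receivers (j : ℕ) {g : (ℕ → Plane) × Plane → ℝ≥0∞} (hg : Measurable g) :
    Measurable fun ω => ∑ k ∈ Finset.range (N.cluster j ω).1,
      g ((fun i => N.tx i ω), N.rx j k ω) :=
  (measurable_sum_cluster hg).comp (N.measurable_tx.prodMk (N.cluster_measurable j))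

lemma covered_iff_sirAt (ℓ : ℝ → ℝ) (T : ℝ) (τ j k : ℕ) (ω : Ω) :
    N.Covered ℓ 0 T τ j k ω ↔ ∃ n ∈ Finset.Icc 1 τ, ENNReal.ofReal T ≤
      sirAt ℓ j (fun i => N.fading j k i n ω) (fun i => N.tx i ω) (N.rx j k ω) := by
  simp only [Covered, sinr, power, sirAt]

variable [IsProbabilityMeasure P]

lemma lintegral_sum_receivers (j : ℕ) {g : (ℕ → Plane) × Plane → ℝ≥0∞} (hg : Measurable g) :
    ∫⁻ ω, ∑ k ∈ Finset.range (N.cluster j ω).1, g ((fun i => N.tx i ω), N.rx j k ω) ∂P =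
      ENNReal.ofReal lamR *
        ∫⁻ ω, (∫⁻ y in Metric.ball (N.tx j ω) R, g ((fun i => N.tx i ω), y)) ∂P := by
  have h1 := N.lintegral_tx_cluster j (measurable_sum_cluster hg)
  refine h1.trans ?_
  rw [← lintegral_const_mul' _ _ ENNReal.ofReal_ne_top]
  exact lintegral_congr fun ω => N.lintegral_clusterLaw (N.tx j ω)
    (g := fun y => g ((fun i => N.tx i ω), y)) (hg.comp measurable_prodMk_left)

/-- The cluster intensity has no atom at the transmitter. The coincidence must be excluded because
the path loss is only assumed positive at positive distance. -/
lemma ae_rx_ne_tx (j : ℕ) :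
    ∀ᵐ ω ∂P, ∀ k < (N.cluster j ω).1, N.rx j k ω ≠ N.tx j ω := by
  have hS : MeasurableSet {p : (ℕ → Plane) × Plane | p.2 = p.1 j} :=
    measurableSet_eq_fun measurable_snd ((measurable_pi_apply j).comp measurable_fst)
  have hmem : ∀ x y, ((x, y) : (ℕ → Plane) × Plane) ∈ {p : (ℕ → Plane) × Plane | p.2 = p.1 j} ↔
      y = x j := fun x y => Iff.rfl
  generalize {p : (ℕ → Plane) × Plane | p.2 = p.1 j} = S at hS hmem
  have hg : Measurable (S.indicator fun _ => (1 : ℝ≥0∞)) := measurable_const.indicator hS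
  have h1 := N.lintegral_sum_receivers j hg
  have h2 : ∀ ω, ∫⁻ y in Metric.ball (N.tx j ω) R,
      S.indicator (fun _ => (1 : ℝ≥0∞)) ((fun i => N.tx i ω), y) = 0 := fun ω => by
    have h3 : ∀ᵐ y ∂(volume.restrict (Metric.ball (N.tx j ω) R)),
        S.indicator (fun _ => (1 : ℝ≥0∞)) ((fun i => N.tx i ω), y) = 0 := by
      refine ae_restrict_of_ae ?_
      have : ∀ᵐ y : Plane, y ≠ N.tx j ω := by
        rw [ae_iff]
        simp
      filter_upwards [this] with y hy
      exact Set.indicator_of_notMem (s := S) (fun h => hy ((hmem _ _).1 h)) _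
    rw [lintegral_congr_ae h3, lintegral_zero]
  simp_rw [h2, lintegral_zero, mul_zero] at h1
  rw [lintegral_eq_zero_iff (N.measurable_sum_receivers j hg)] at h1
  filter_upwards [h1] with ω hω k hk h
  have h3 := Finset.sum_eq_zero_iff.1 hω k (Finset.mem_range.2 hk)
  rw [Set.indicator_of_mem ((hmem _ _).2 h)] at h3
  exact one_ne_zero h3

lemma measure_exists_fading {ℓ : ℝ → ℝ} (hℓ : Measurable ℓ) (T : ℝ) (τ j k : ℕ)
    {x : ℕ → Plane} {y : Plane} (hd : 0 < ℓ (dist (x j) y)) :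
    P {ω | ∃ n ∈ Finset.Icc 1 τ,
      ENNReal.ofReal T ≤ sirAt ℓ j (fun i => N.fading j k i n ω) x y} =
      coverProb ℓ T τ j x y := by
  have hinj : Function.Injective fun p : ℕ × ℕ => (j, k, p.2, p.1) := fun p q hpq => by
    simp only [Prod.mk.injEq, true_and] at hpq
    exact Prod.ext hpq.2 hpq.1
  have hind : iIndepFun (fun p : ℕ × ℕ => N.fading j k p.2 p.1) P :=
    N.fading_iIndep.precomp hinj
  rw [coverProb]
  exact measure_exists_le_sirAt (F := fun n i => N.fading j k i n)
    (fun n i => N.fading_measurable j k i n) (fun n i => N.fading_law j k i n) hind hℓ τ hd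

/-- Fading is independent of all positions, so the positions can be frozen and the fixed-position
probability averaged afterwards. -/
lemma measure_covered {ℓ : ℝ → ℝ} (hℓ : Measurable ℓ) (hpos : ∀ r, 0 < r → 0 < ℓ r) (T : ℝ)
    (τ j k : ℕ) {B : Set Plane} (hB : MeasurableSet B) :
    MeasurableSet {ω | N.tx j ω ∈ B ∧ k < (N.cluster j ω).1 ∧ N.Covered ℓ 0 T τ j k ω} ∧
    P {ω | N.tx j ω ∈ B ∧ k < (N.cluster j ω).1 ∧ N.Covered ℓ 0 T τ j k ω} =
      ∫⁻ ω, {ω | N.tx j ω ∈ B ∧ k < (N.cluster j ω).1}.indicator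
        (fun ω => coverProb ℓ T τ j (fun i => N.tx i ω) (N.rx j k ω)) ω ∂P := by
  have hcl : Measurable fun p : (ℕ × ℕ × ℕ × ℕ → ℝ) × ((ℕ → Plane) × (ℕ → Cluster)) =>
      p.2.2 j := (measurable_pi_apply j).comp (measurable_snd.comp measurable_snd)
  have hS : MeasurableSet {p : (ℕ × ℕ × ℕ × ℕ → ℝ) × ((ℕ → Plane) × (ℕ → Cluster)) |
      p.2.1 j ∈ B ∧ k < (p.2.2 j).1 ∧ ∃ n ∈ Finset.Icc 1 τ,
      ENNReal.ofReal T ≤ sirAt ℓ j (fun i => p.1 (j, k, i, n)) p.2.1 ((p.2.2 j).2 k)} := by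
    have s1 : MeasurableSet {p : (ℕ × ℕ × ℕ × ℕ → ℝ) × ((ℕ → Plane) × (ℕ → Cluster)) |
        p.2.1 j ∈ B} := ((measurable_pi_apply j).comp (measurable_fst.comp measurable_snd)) hB
    have s2 : MeasurableSet {p : (ℕ × ℕ × ℕ × ℕ → ℝ) × ((ℕ → Plane) × (ℕ → Cluster)) |
        k < (p.2.2 j).1} := (measurable_fst.comp hcl) measurableSet_Ioi
    have s3 : ∀ n, MeasurableSet {p : (ℕ × ℕ × ℕ × ℕ → ℝ) × ((ℕ → Plane) × (ℕ → Cluster)) |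
        ENNReal.ofReal T ≤ sirAt ℓ j (fun i => p.1 (j, k, i, n)) p.2.1 ((p.2.2 j).2 k)} :=
      fun n => measurableSet_le measurable_const (measurable_sirAt hℓ j
        (fun i => (measurable_pi_apply _).comp measurable_fst)
        (fun i => (measurable_pi_apply i).comp (measurable_fst.comp measurable_snd))
        ((measurable_pi_apply k).comp (measurable_snd.comp hcl)))
    have s4 : MeasurableSet {p : (ℕ × ℕ × ℕ × ℕ → ℝ) × ((ℕ → Plane) × (ℕ → Cluster)) |
        ∃ n ∈ Finset.Icc 1 τ,
          ENNReal.ofReal T ≤ sirAt ℓ j (fun i => p.1 (j, k, i, n)) p.2.1 ((p.2.2 j).2 k)} := by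
      have : {p : (ℕ × ℕ × ℕ × ℕ → ℝ) × ((ℕ → Plane) × (ℕ → Cluster)) |
        ∃ n ∈ Finset.Icc 1 τ,
          ENNReal.ofReal T ≤ sirAt ℓ j (fun i => p.1 (j, k, i, n)) p.2.1 ((p.2.2 j).2 k)} =
          ⋃ n ∈ Finset.Icc 1 τ, {p : (ℕ × ℕ × ℕ × ℕ → ℝ) × ((ℕ → Plane) × (ℕ → Cluster)) |
          ENNReal.ofReal T ≤ sirAt ℓ j (fun i => p.1 (j, k, i, n)) p.2.1 ((p.2.2 j).2 k)} := by
        ext p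
        simp
      rw [this]
      exact Finset.measurableSet_biUnion _ fun n _ => s3 n
    exact s1.inter (s2.inter s4)
  have hmem : ∀ f x c, ((f, (x, c)) : (ℕ × ℕ × ℕ × ℕ → ℝ) × ((ℕ → Plane) × (ℕ → Cluster))) ∈
      {p : (ℕ × ℕ × ℕ × ℕ → ℝ) × ((ℕ → Plane) × (ℕ → Cluster)) |
      p.2.1 j ∈ B ∧ k < (p.2.2 j).1 ∧ ∃ n ∈ Finset.Icc 1 τ,
      ENNReal.ofReal T ≤ sirAt ℓ j (fun i => p.1 (j, k, i, n)) p.2.1 ((p.2.2 j).2 k)} ↔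
      x j ∈ B ∧ k < (c j).1 ∧ ∃ n ∈ Finset.Icc 1 τ,
      ENNReal.ofReal T ≤ sirAt ℓ j (fun i => f (j, k, i, n)) x ((c j).2 k) :=
    fun f x c => Iff.rfl
  generalize {p : (ℕ × ℕ × ℕ × ℕ → ℝ) × ((ℕ → Plane) × (ℕ → Cluster)) |
      p.2.1 j ∈ B ∧ k < (p.2.2 j).1 ∧ ∃ n ∈ Finset.Icc 1 τ,
      ENNReal.ofReal T ≤ sirAt ℓ j (fun i => p.1 (j, k, i, n)) p.2.1 ((p.2.2 j).2 k)} = S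
    at hS hmem
  have hX : Measurable fun ω (q : ℕ × ℕ × ℕ × ℕ) => N.fading q.1 q.2.1 q.2.2.1 q.2.2.2 ω :=
    measurable_pi_iff.2 fun q => N.fading_measurable _ _ _ _
  have hY : Measurable fun ω => ((fun j => N.tx j ω), (fun j => N.cluster j ω)) :=
    N.measurable_tx.prodMk (measurable_pi_iff.2 N.cluster_measurable)
  have hset : {ω | N.tx j ω ∈ B ∧ k < (N.cluster j ω).1 ∧ N.Covered ℓ 0 T τ j k ω} =
      {ω | ((fun q : ℕ × ℕ × ℕ × ℕ => N.fading q.1 q.2.1 q.2.2.1 q.2.2.2 ω),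
        ((fun j => N.tx j ω), (fun j => N.cluster j ω))) ∈ S} := by
    ext ω
    rw [Set.mem_ofPred_eq, Set.mem_ofPred_eq, hmem, N.covered_iff_sirAt]
    simp only [rx]
  rw [hset]
  refine ⟨(hX.prodMk hY) hS, ?_⟩
  rw [measure_eq_lintegral_of_indepFun hX hY N.fading_indep_positions hS]
  refine lintegral_congr_ae ?_
  filter_upwards [N.ae_rx_ne_tx j] with ω hω
  simp_rw [hmem]
  by_cases h : N.tx j ω ∈ B ∧ k < (N.cluster j ω).1
  · rw [Set.indicator_of_mem (show ω ∈ {ω | N.tx j ω ∈ B ∧ k < (N.cluster j ω).1} from h)]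
    have hd : 0 < ℓ (dist (N.tx j ω) (N.rx j k ω)) :=
      hpos _ (dist_pos.2 (hω k h.2).symm)
    have hc := N.measure_exists_fading hℓ T τ j k (x := fun i => N.tx i ω) (y := N.rx j k ω) hd
    rw [← hc]
    simp only [h.1, h.2, true_and, rx]
  · rw [Set.indicator_of_notMem (show ω ∉ {ω | N.tx j ω ∈ B ∧ k < (N.cluster j ω).1} from h)]
    simp only [← and_assoc, h, false_and]
    simp

open Classical in
lemma lintegral_indicator_numCovered {ℓ : ℝ → ℝ} (hℓ : Measurable ℓ)
    (hpos : ∀ r, 0 < r → 0 < ℓ r) (T : ℝ) (τ j : ℕ) {B : Set Plane} (hB : MeasurableSet B) :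
    Measurable (fun ω => B.indicator (fun _ => (N.numCovered ℓ 0 T τ j ω : ℝ≥0∞)) (N.tx j ω)) ∧
    ∫⁻ ω, B.indicator (fun _ => (N.numCovered ℓ 0 T τ j ω : ℝ≥0∞)) (N.tx j ω) ∂P =
      ENNReal.ofReal lamR * ∫⁻ ω, (∫⁻ y, (B ∩ Metric.ball y R).indicator
        (fun _ => coverProb ℓ T τ j (fun i => N.tx i ω) y) (N.tx j ω)) ∂P := by
  have e1 : ∀ ω, B.indicator (fun _ => (N.numCovered ℓ 0 T τ j ω : ℝ≥0∞)) (N.tx j ω) =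
      ∑' k, {ω | N.tx j ω ∈ B ∧ k < (N.cluster j ω).1 ∧ N.Covered ℓ 0 T τ j k ω}.indicator
        (fun _ => (1 : ℝ≥0∞)) ω := fun ω => by
    rw [tsum_eq_sum (s := Finset.range (N.cluster j ω).1)]
    · by_cases hω : N.tx j ω ∈ B
      · rw [Set.indicator_of_mem hω, numCovered, Finset.card_filter, Nat.cast_sum]
        refine Finset.sum_congr rfl fun k hk => ?_
        rw [Finset.mem_range] at hk
        by_cases hc : N.Covered ℓ 0 T τ j k ω <;> simp [Set.indicator, hω, hk, hc]
      · simp [Set.indicator, hω]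
    · intro k hk
      refine Set.indicator_of_notMem (fun h => hk ?_) _
      exact Finset.mem_range.2 h.2.1
  have hmc : ∀ k, MeasurableSet {ω | N.tx j ω ∈ B ∧ k < (N.cluster j ω).1} := fun k =>
    (N.tx_measurable j hB).inter
      ((measurable_fst.comp (N.cluster_measurable j)) measurableSet_Ioi)
  have hmi : ∀ k, Measurable ({ω | N.tx j ω ∈ B ∧ k < (N.cluster j ω).1}.indicator
      fun ω => coverProb ℓ T τ j (fun i => N.tx i ω) (N.rx j k ω)) := fun k =>
    Measurable.indicator (measurable_coverProb hℓ T τ j N.tx_measurable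
      ((measurable_pi_apply k).comp (measurable_snd.comp (N.cluster_measurable j)))) (hmc k)
  obtain ⟨g, hg, hgB⟩ : ∃ g : (ℕ → Plane) × Plane → ℝ≥0∞, Measurable g ∧
      ∀ x y, g (x, y) = B.indicator (fun _ => coverProb ℓ T τ j x y) (x j) :=
    ⟨fun p => B.indicator (fun _ => coverProb ℓ T τ j p.1 p.2) (p.1 j),
      (measurable_coverProb hℓ T τ j (fun i => (measurable_pi_apply i).comp measurable_fst)
        measurable_snd).indicator (((measurable_pi_apply j).comp measurable_fst) hB),
      fun x y => rfl⟩
  have e2 : ∀ ω, ∑' k, {ω | N.tx j ω ∈ B ∧ k < (N.cluster j ω).1}.indicator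
      (fun ω => coverProb ℓ T τ j (fun i => N.tx i ω) (N.rx j k ω)) ω =
      ∑ k ∈ Finset.range (N.cluster j ω).1, g ((fun i => N.tx i ω), N.rx j k ω) :=
    fun ω => by
      rw [tsum_eq_sum (s := Finset.range (N.cluster j ω).1)]
      · refine Finset.sum_congr rfl fun k hk => ?_
        rw [Finset.mem_range] at hk
        by_cases hω : N.tx j ω ∈ B <;> simp [hgB, Set.indicator, hω, hk]
      · intro k hk
        refine Set.indicator_of_notMem (fun h => hk ?_) _
        exact Finset.mem_range.2 h.2
  simp_rw [e1]
  refine ⟨Measurable.tsum fun k => measurable_const.indicator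
    (N.measure_covered hℓ hpos T τ j k hB).1, ?_⟩
  rw [lintegral_tsum fun k => (measurable_const.indicator
    (N.measure_covered hℓ hpos T τ j k hB).1).aemeasurable]
  simp_rw [fun k => lintegral_indicator_const (μ := P)
    (N.measure_covered hℓ hpos T τ j k hB).1 (1 : ℝ≥0∞), one_mul,
    fun k => (N.measure_covered hℓ hpos T τ j k hB).2]
  rw [← lintegral_tsum fun k => (hmi k).aemeasurable, lintegral_congr e2,
    N.lintegral_sum_receivers j hg]
  congr 1
  refine lintegral_congr fun ω => ?_
  rw [← lintegral_indicator Metric.isOpen_ball.measurableSet]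
  refine lintegral_congr fun y => ?_
  -- The condition |x_j - y| < R is reread as `x_j` lying in the ball around `y`, the form in which
  -- `y` can be fixed and Mecke applied.
  by_cases h1 : N.tx j ω ∈ B <;> by_cases h2 : dist (N.tx j ω) y < R <;>
    simp [hgB, Set.indicator, h1, h2, dist_comm y]

/-- The expected number of covered receivers of the transmitters in `B`, as an integral over the
positions of the receivers. -/
lemma lintegral_tsum_numCovered {ℓ : ℝ → ℝ} (hℓ : Measurable ℓ)
    (hpos : ∀ r, 0 < r → 0 < ℓ r) (T : ℝ) (τ : ℕ) {B : Set Plane} (hB : MeasurableSet B) :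
    ∫⁻ ω, ∑' j, B.indicator (fun _ => (N.numCovered ℓ 0 T τ j ω : ℝ≥0∞)) (N.tx j ω) ∂P =
      ENNReal.ofReal lamR * ∑' j, ∫⁻ ω, (∫⁻ y, (B ∩ Metric.ball y R).indicator
        (fun _ => coverProb ℓ T τ j (fun i => N.tx i ω) y) (N.tx j ω)) ∂P := by
  rw [lintegral_tsum fun j =>
    (N.lintegral_indicator_numCovered hℓ hpos T τ j hB).1.aemeasurable, ← ENNReal.tsum_mul_left]
  exact tsum_congr fun j => (N.lintegral_indicator_numCovered hℓ hpos T τ j hB).2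

end Network

/-! ### The constant K and radial integrals in the plane -/

lemma one_sub_one_div_pow_nonneg {t : ℝ} (ht : 0 ≤ t) (n : ℕ) : 0 ≤ 1 - 1 / (1 + t) ^ n := by
  rw [sub_nonneg, div_le_one (by positivity)]
  exact one_le_pow₀ (by linarith)

lemma one_sub_one_div_pow_le_one {t : ℝ} (ht : 0 ≤ t) (n : ℕ) : 1 - 1 / (1 + t) ^ n ≤ 1 := by
  have : 0 ≤ 1 / (1 + t) ^ n := by positivity
  linarith

/-- Bernoulli's inequality at -t/(1+t). This linear bound makes the integrand of `K` at most n
t^(-2/α) near 0, integrable because α > 2. -/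
lemma one_sub_one_div_pow_le_mul {t : ℝ} (ht : 0 ≤ t) (n : ℕ) :
    1 - 1 / (1 + t) ^ n ≤ n * t := by
  have h1 : 1 + (n : ℝ) * (-(t / (1 + t))) ≤ (1 + -(t / (1 + t))) ^ n := by
    refine one_add_mul_le_pow ?_ n
    have : t / (1 + t) ≤ 1 := (div_le_one (by positivity)).2 (by linarith)
    linarith
  have h2 : 1 + -(t / (1 + t)) = 1 / (1 + t) := by
    field_simp
    ring
  have h3 : t / (1 + t) ≤ t := div_le_self ht (by linarith)
  have h4 := mul_le_mul_of_nonneg_left h3 (Nat.cast_nonneg (α := ℝ) n)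
  rw [h2, one_div_pow] at h1
  linarith

lemma integrableOn_K {α : ℝ} (hα : 2 < α) (n : ℕ) :
    IntegrableOn (fun t : ℝ => t ^ (-(2 / α) - 1) * (1 - 1 / (1 + t) ^ n)) (Set.Ioi 0) := by
  have h2α : 2 / α < 1 := (div_lt_one (by linarith)).2 hα
  have h0α : 0 < 2 / α := by positivity
  have hm : Measurable fun t : ℝ => t ^ (-(2 / α) - 1) * (1 - 1 / (1 + t) ^ n) := by fun_prop
  rw [← Set.Ioc_union_Ioi_eq_Ioi zero_le_one]
  refine IntegrableOn.union ?_ ?_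
  · have h1 : IntegrableOn (fun t : ℝ => (n : ℝ) * t ^ (-(2 / α))) (Set.Ioc 0 1) :=
      ((intervalIntegrable_iff_integrableOn_Ioc_of_le zero_le_one).1
        (intervalIntegral.intervalIntegrable_rpow' (by linarith))).const_mul _
    refine h1.mono' hm.aestronglyMeasurable ?_
    filter_upwards [ae_restrict_mem measurableSet_Ioc] with t ht
    rw [Real.norm_of_nonneg (mul_nonneg (Real.rpow_nonneg ht.1.le _)
      (one_sub_one_div_pow_nonneg ht.1.le n)), Real.rpow_sub_one ht.1.ne']
    calc t ^ (-(2 / α)) / t * (1 - 1 / (1 + t) ^ n) ≤ t ^ (-(2 / α)) / t * (n * t) :=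
          mul_le_mul_of_nonneg_left (one_sub_one_div_pow_le_mul ht.1.le n)
            (div_nonneg (Real.rpow_nonneg ht.1.le _) ht.1.le)
      _ = n * t ^ (-(2 / α)) := by
          have := ht.1.ne'
          field_simp
  · have h1 : IntegrableOn (fun t : ℝ => t ^ (-(2 / α) - 1)) (Set.Ioi 1) :=
      integrableOn_Ioi_rpow_of_lt (by linarith) zero_lt_one
    refine h1.mono' hm.aestronglyMeasurable ?_
    filter_upwards [ae_restrict_mem measurableSet_Ioi] with t ht
    have ht0 : 0 ≤ t := zero_le_one.trans (le_of_lt ht)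
    rw [Real.norm_of_nonneg (mul_nonneg (Real.rpow_nonneg ht0 _)
      (one_sub_one_div_pow_nonneg ht0 n))]
    exact mul_le_of_le_one_right (Real.rpow_nonneg ht0 _) (one_sub_one_div_pow_le_one ht0 n)

lemma K_pos {α : ℝ} (hα : 2 < α) {n : ℕ} (hn : 1 ≤ n) : 0 < K α n := by
  have hpos : ∀ t ∈ Set.Ioi (0 : ℝ), 0 < t ^ (-(2 / α) - 1) * (1 - 1 / (1 + t) ^ n) :=
    fun t ht => by
      have ht' : 0 < t := ht
      refine mul_pos (Real.rpow_pos_of_pos ht' _) ?_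
      rw [sub_pos, div_lt_one (by positivity)]
      exact one_lt_pow₀ (by linarith) (by omega)
  unfold K
  refine mul_pos (by positivity) ?_
  rw [setIntegral_pos_iff_support_of_nonneg_ae
    ((ae_restrict_mem measurableSet_Ioi).mono fun t ht => (hpos t ht).le) (integrableOn_K hα n)]
  have : Set.Ioi (0 : ℝ) ⊆ Function.support
      (fun t : ℝ => t ^ (-(2 / α) - 1) * (1 - 1 / (1 + t) ^ n)) ∩ Set.Ioi 0 :=
    fun t ht => ⟨(hpos t ht).ne', ht⟩
  refine lt_of_lt_of_le ?_ (measure_mono this)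
  simp

/-- The substitution t = c s^(-α) reduces the radial integral to the one defining `K`. -/
lemma integral_radial_K {α : ℝ} (hα : 2 < α) (n : ℕ) {c : ℝ} (hc : 0 < c) :
    IntegrableOn (fun s : ℝ => s * (1 - 1 / (1 + c / s ^ α) ^ n)) (Set.Ioi 0) ∧
    2 * Real.pi * ∫ s in Set.Ioi (0 : ℝ), s * (1 - 1 / (1 + c / s ^ α) ^ n) =
      K α n * c ^ (2 / α) := by
  have hα0 : 0 < α := by linarith
  set g : ℝ → ℝ := fun t => t ^ (-(2 / α) - 1) * (1 - 1 / (1 + t) ^ n) with hg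
  have hgi : IntegrableOn g (Set.Ioi 0) := integrableOn_K hα n
  have e1 : ∀ s ∈ Set.Ioi (0 : ℝ), (|-α| * s ^ (-α - 1)) • (fun u => g (c * u)) (s ^ (-α)) =
      (α * c ^ (-(2 / α) - 1)) * (s * (1 - 1 / (1 + c / s ^ α) ^ n)) := fun s hs => by
    have hs' : 0 < s := hs
    simp only [hg, smul_eq_mul, abs_neg, abs_of_pos hα0]
    rw [Real.mul_rpow hc.le (Real.rpow_nonneg hs'.le _), ← Real.rpow_mul hs'.le,
      Real.rpow_neg hs'.le α, ← div_eq_mul_inv]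
    have : s ^ (-α - 1) * s ^ (-α * (-(2 / α) - 1)) = s := by
      rw [← Real.rpow_add hs']
      have : -α - 1 + -α * (-(2 / α) - 1) = 1 := by
        field_simp
        ring
      rw [this, Real.rpow_one]
    calc _ = α * c ^ (-(2 / α) - 1) * (s ^ (-α - 1) * s ^ (-α * (-(2 / α) - 1))) *
          (1 - 1 / (1 + c / s ^ α) ^ n) := by ring
      _ = _ := by rw [this]; ring
  have hcoef : α * c ^ (-(2 / α) - 1) ≠ 0 := (mul_pos hα0 (Real.rpow_pos_of_pos hc _)).ne'
  have hi1 : IntegrableOn (fun u => g (c * u)) (Set.Ioi 0) := by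
    rw [integrableOn_Ioi_comp_mul_left_iff g 0 hc, mul_zero]
    exact hgi
  have hi2 := (integrableOn_Ioi_comp_rpow_iff (fun u => g (c * u)) (neg_ne_zero.2 hα0.ne')).2 hi1
  have hint := integral_comp_rpow_Ioi (fun u => g (c * u)) (neg_ne_zero.2 hα0.ne')
  rw [integrableOn_congr_fun e1 measurableSet_Ioi] at hi2
  rw [setIntegral_congr_fun measurableSet_Ioi e1, integral_const_mul,
    integral_comp_mul_left_Ioi g 0 hc, mul_zero, smul_eq_mul] at hint
  constructor
  · refine (hi2.const_mul (α * c ^ (-(2 / α) - 1))⁻¹).congr ?_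
    refine ae_of_all _ fun s => ?_
    simp only []
    rw [inv_mul_cancel_left₀ hcoef]
  · have hK : K α n = 2 * Real.pi / α * ∫ t in Set.Ioi (0 : ℝ), g t := rfl
    have h3 : (∫ s in Set.Ioi (0 : ℝ), s * (1 - 1 / (1 + c / s ^ α) ^ n)) =
        (α * c ^ (-(2 / α) - 1))⁻¹ * (c⁻¹ * ∫ t in Set.Ioi (0 : ℝ), g t) := by
      rw [← hint, inv_mul_cancel_left₀ hcoef]
    rw [hK, h3, Real.rpow_sub_one hc.ne', Real.rpow_neg hc.le]
    have := Real.rpow_pos_of_pos hc (2 / α)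
    field_simp

lemma integral_plane_radial (f : ℝ → ℝ) :
    ∫ z : Plane, f ‖z‖ = 2 * Real.pi * ∫ s in Set.Ioi (0 : ℝ), s * f s := by
  have h := integral_fun_norm_addHaar (volume : Measure Plane) f
  rw [h]
  simp [measureReal_def, EuclideanSpace.volume_ball_fin_two,
    ENNReal.toReal_ofReal Real.pi_pos.le]
  ring

lemma integrable_plane_radial {f : ℝ → ℝ} (h : IntegrableOn (fun s => s * f s) (Set.Ioi 0)) :
    Integrable fun z : Plane => f ‖z‖ := by
  rw [integrable_fun_norm_addHaar (volume : Measure Plane) (f := f)]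
  simpa using h

lemma lintegral_plane_radial {f : ℝ → ℝ} (h : IntegrableOn (fun s => s * f s) (Set.Ioi 0))
    (h0 : ∀ s, 0 ≤ s → 0 ≤ f s) :
    ∫⁻ z : Plane, ENNReal.ofReal (f ‖z‖) =
      ENNReal.ofReal (2 * Real.pi * ∫ s in Set.Ioi (0 : ℝ), s * f s) := by
  rw [← integral_plane_radial, ofReal_integral_eq_lintegral_ofReal (integrable_plane_radial h)
    (ae_of_all _ fun z => h0 _ (norm_nonneg z))]

lemma expNeg_mul_interferenceExponent (ℓ : ℝ → ℝ) (T r s : ℝ) (n : ℕ) :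
    expNeg (n * interferenceExponent ℓ T r s) =
      ((1 + ENNReal.ofReal T * ENNReal.ofReal (ℓ r) / ENNReal.ofReal (ℓ s))⁻¹) ^ n := by
  rw [expNeg_nat_mul, interferenceExponent, expNeg_negLog (by simp)]

lemma lintegral_one_sub_expNeg {α A T : ℝ} (hα : 2 < α) (hA : 0 < A) (hT : 0 < T) (n : ℕ)
    (y : Plane) {r : ℝ} (hr : 0 ≤ r) :
    ∫⁻ z : Plane, (1 - expNeg (n * interferenceExponent (fun r => A * r ^ α) T r (dist z y))) =
      ENNReal.ofReal (K α n * T ^ (2 / α) * r ^ 2) := by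
  have hα0 : 0 < α := by linarith
  simp_rw [expNeg_mul_interferenceExponent]
  -- At r = 0 the path loss vanishes, so both sides are 0; the substitution needs c > 0.
  rcases hr.eq_or_lt with rfl | hr
  · simp [Real.zero_rpow hα0.ne']
  set c : ℝ := T * r ^ α with hc
  have hc0 : 0 < c := mul_pos hT (Real.rpow_pos_of_pos hr _)
  obtain ⟨hi, hK⟩ := integral_radial_K hα n hc0
  have hcα : c ^ (2 / α) = T ^ (2 / α) * r ^ 2 := by
    rw [hc, Real.mul_rpow hT.le (Real.rpow_nonneg hr.le _), ← Real.rpow_mul hr.le,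
      mul_div_cancel₀ _ hα0.ne', Real.rpow_two]
  rw [mul_assoc, ← hcα, ← hK, ← lintegral_plane_radial hi fun s hs =>
    one_sub_one_div_pow_nonneg (div_nonneg hc0.le (Real.rpow_nonneg hs _)) n,
    ← lintegral_sub_right_eq_self
      (fun z : Plane => ENNReal.ofReal (1 - 1 / (1 + c / ‖z‖ ^ α) ^ n)) y]
  have hne : ∀ᵐ z : Plane, z ≠ y := by
    rw [ae_iff]
    simp
  refine lintegral_congr_ae ?_
  filter_upwards [hne] with z hz
  have hs : 0 < dist z y := dist_pos.2 hz
  rw [← dist_eq_norm]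
  set s := dist z y
  have hsα : 0 < s ^ α := Real.rpow_pos_of_pos hs _
  have hq : 0 ≤ c / s ^ α := div_nonneg hc0.le hsα.le
  rw [← ENNReal.ofReal_mul hT.le, ← ENNReal.ofReal_div_of_pos (mul_pos hA hsα),
    ENNReal.ofReal_sub _ (by positivity), ENNReal.ofReal_one, one_div,
    ENNReal.ofReal_inv_of_pos (by positivity), ENNReal.ofReal_pow (by positivity),
    ENNReal.ofReal_add zero_le_one hq, ENNReal.ofReal_one, ENNReal.inv_pow]
  congr 5
  rw [hc]
  field_simp

lemma lintegral_ball_exp {c R : ℝ} (hc : 0 < c) (hR : 0 < R) (x : Plane) :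
    ∫⁻ y in Metric.ball x R, ENNReal.ofReal (Real.exp (-(c * dist x y ^ 2))) =
      ENNReal.ofReal (Real.pi / c * (1 - Real.exp (-(c * R ^ 2)))) := by
  set f : ℝ → ℝ := (Set.Iio R).indicator fun s => Real.exp (-(c * s ^ 2)) with hf
  have hcont : Continuous fun s : ℝ => s * Real.exp (-(c * s ^ 2)) := by fun_prop
  have e1 : ∀ s, s * f s = (Set.Iio R).indicator (fun s => s * Real.exp (-(c * s ^ 2))) s :=
    fun s => by by_cases hs : s < R <;> simp [hf, hs]
  have hinter : Set.Iio R ∩ Set.Ioi 0 = Set.Ioo 0 R := by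
    ext s
    simp [and_comm]
  have hi : IntegrableOn (fun s => s * f s) (Set.Ioi 0) := by
    simp_rw [e1]
    rw [IntegrableOn, integrable_indicator_iff measurableSet_Iio, IntegrableOn,
      Measure.restrict_restrict measurableSet_Iio, hinter]
    exact (hcont.integrableOn_Icc).mono_set Set.Ioo_subset_Icc_self
  have hval : ∫ s in Set.Ioi (0 : ℝ), s * f s = (1 - Real.exp (-(c * R ^ 2))) / (2 * c) := by
    simp_rw [e1]
    rw [integral_indicator measurableSet_Iio, Measure.restrict_restrict measurableSet_Iio, hinter,
      ← integral_Ioc_eq_integral_Ioo, ← intervalIntegral.integral_of_le hR.le]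
    have hd : ∀ s ∈ Set.uIcc 0 R, HasDerivAt (fun s : ℝ => -Real.exp (-(c * s ^ 2)) / (2 * c))
        (s * Real.exp (-(c * s ^ 2))) s := fun s _ => by
      have h1 : HasDerivAt (fun s : ℝ => -(c * s ^ 2)) (-(c * (2 * s))) s := by
        have := ((hasDerivAt_pow 2 s).const_mul c).neg
        simp only [Nat.cast_ofNat, Nat.add_one_sub_one, pow_one] at this
        exact this
      refine (h1.exp.neg.div_const (2 * c)).congr_deriv ?_
      field_simp
    rw [intervalIntegral.integral_eq_sub_of_hasDerivAt hd (hcont.intervalIntegrable 0 R)]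
    simp only [ne_eq, OfNat.ofNat_ne_zero, not_false_eq_true, zero_pow, mul_zero, neg_zero,
      Real.exp_zero]
    ring
  have h0 : ∀ s, 0 ≤ s → 0 ≤ f s := fun s _ =>
    Set.indicator_nonneg (fun _ _ => (Real.exp_pos _).le) s
  have h := lintegral_plane_radial hi h0
  rw [hval, ← lintegral_sub_right_eq_self (fun z : Plane => ENNReal.ofReal (f ‖z‖)) x] at h
  rw [← lintegral_indicator Metric.isOpen_ball.measurableSet]
  refine Eq.trans (lintegral_congr fun y => ?_) (h.trans ?_)
  · rw [← dist_eq_norm]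
    by_cases hy : dist y x < R
    · rw [Set.indicator_of_mem (Metric.mem_ball.2 hy), hf,
        Set.indicator_of_mem (s := Set.Iio R) hy, dist_comm]
    · rw [Set.indicator_of_notMem (fun h => hy (Metric.mem_ball.1 h)), hf,
        Set.indicator_of_notMem (s := Set.Iio R) hy, ENNReal.ofReal_zero]
  · congr 1
    field_simp

/-! ### Inclusion–exclusion over transmissions and exchanges of integrals -/

lemma one_sub_one_sub_pow (x : ℝ) (τ : ℕ) :
    1 - (1 - x) ^ τ =
      ∑ n ∈ Finset.Icc 1 τ, (-1 : ℝ) ^ (n + 1) * (τ.choose n : ℝ) * x ^ n := by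
  have h : (1 - x) ^ τ = ∑ n ∈ Finset.range (τ + 1), (-1 : ℝ) ^ n * (τ.choose n : ℝ) * x ^ n := by
    rw [sub_eq_neg_add, add_pow]
    refine Finset.sum_congr rfl fun n _ => ?_
    rw [neg_pow, one_pow]
    ring
  have hr : Finset.range (τ + 1) = insert 0 (Finset.Icc 1 τ) := by
    ext n
    simp only [Finset.mem_range, Finset.mem_insert, Finset.mem_Icc]
    omega
  rw [h, hr, Finset.sum_insert (by simp)]
  simp only [pow_zero, Nat.choose_zero_right, Nat.cast_one, mul_one, sub_add_cancel_left,
    ← Finset.sum_neg_distrib]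
  refine Finset.sum_congr rfl fun n _ => ?_
  rw [pow_succ]
  ring

/-- The alternating signs force a passage from [0, ∞] to ℝ; on a finite measure the bound `s ≤ 1`
makes every power integrable. -/
lemma toReal_lintegral_one_sub_pow {E : Type*} [MeasurableSpace E] {μ : Measure E}
    [IsFiniteMeasure μ] {s : E → ℝ≥0∞} (hs : Measurable s) (hs1 : ∀ x, s x ≤ 1) (τ : ℕ) :
    (∫⁻ x, (1 - (1 - s x) ^ τ) ∂μ).toReal =
      ∑ n ∈ Finset.Icc 1 τ, (-1 : ℝ) ^ (n + 1) * (τ.choose n : ℝ) *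
        (∫⁻ x, s x ^ n ∂μ).toReal := by
  have hst : ∀ x, s x ≠ ∞ := fun x => ((hs1 x).trans_lt ENNReal.one_lt_top).ne
  have hm1 : Measurable fun x => 1 - (1 - s x) ^ τ := ((hs.const_sub 1).pow_const τ).const_sub 1
  have hreal : ∀ x, (1 - (1 - s x) ^ τ).toReal = 1 - (1 - (s x).toReal) ^ τ := fun x => by
    have h1 : (1 - s x) ^ τ ≤ 1 := pow_le_one₀ bot_le tsub_le_self
    rw [ENNReal.toReal_sub_of_le h1 ENNReal.one_ne_top, ENNReal.toReal_pow,
      ENNReal.toReal_sub_of_le (hs1 x) ENNReal.one_ne_top, ENNReal.toReal_one]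
  have hint : ∀ n : ℕ, Integrable (fun x => (s x).toReal ^ n) μ := fun n => by
    refine Integrable.of_bound (hs.ennreal_toReal.pow_const n).aestronglyMeasurable 1
      (ae_of_all _ fun x => ?_)
    rw [Real.norm_of_nonneg (by positivity)]
    refine pow_le_one₀ ENNReal.toReal_nonneg ?_
    exact ENNReal.toReal_le_of_le_ofReal zero_le_one (by simpa using hs1 x)
  rw [← integral_toReal hm1.aemeasurable (ae_of_all _ fun x =>
    tsub_le_self.trans_lt ENNReal.one_lt_top)]
  simp_rw [hreal, one_sub_one_sub_pow]
  rw [integral_finsetSum _ fun n _ => (hint n).const_mul _]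
  refine Finset.sum_congr rfl fun n _ => ?_
  rw [integral_const_mul, ← integral_toReal (hs.pow_const n).aemeasurable (ae_of_all _ fun x =>
    ENNReal.pow_lt_top (hst x).lt_top)]
  simp_rw [ENNReal.toReal_pow]

lemma lintegral_lintegral_ball {φ : ℝ → ℝ≥0∞} (hφ : Measurable φ) {B : Set Plane}
    (hB : MeasurableSet B) (R : ℝ) :
    ∫⁻ y : Plane, (∫⁻ x in B ∩ Metric.ball y R, φ (dist x y)) =
      ∫⁻ x in B, (∫⁻ y in Metric.ball x R, φ (dist x y)) := by
  have hS : MeasurableSet {p : Plane × Plane | p.2 ∈ B ∧ dist p.2 p.1 < R} :=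
    (measurable_snd hB).inter
      (measurableSet_lt (measurable_snd.dist measurable_fst) measurable_const)
  have hf : Measurable ({p : Plane × Plane | p.2 ∈ B ∧ dist p.2 p.1 < R}.indicator
      fun p => φ (dist p.2 p.1)) :=
    (hφ.comp (measurable_snd.dist measurable_fst)).indicator hS
  have h1 : ∀ y : Plane, (∫⁻ x in B ∩ Metric.ball y R, φ (dist x y)) =
      ∫⁻ x, {p : Plane × Plane | p.2 ∈ B ∧ dist p.2 p.1 < R}.indicator
        (fun p => φ (dist p.2 p.1)) (y, x) := fun y => by
    rw [← lintegral_indicator (hB.inter Metric.isOpen_ball.measurableSet)]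
    exact lintegral_congr fun x => rfl
  have h2 : (∫⁻ x in B, (∫⁻ y in Metric.ball x R, φ (dist x y))) =
      ∫⁻ x, (∫⁻ y, {p : Plane × Plane | p.2 ∈ B ∧ dist p.2 p.1 < R}.indicator
        (fun p => φ (dist p.2 p.1)) (y, x)) := by
    rw [← lintegral_indicator hB]
    refine lintegral_congr fun x => ?_
    by_cases hx : x ∈ B
    · rw [Set.indicator_of_mem hx, ← lintegral_indicator Metric.isOpen_ball.measurableSet]
      refine lintegral_congr fun y => ?_
      simp [Set.indicator, hx, dist_comm y]
    · simp [Set.indicator, hx]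
  rw [h2]
  simp_rw [h1]
  exact lintegral_lintegral_swap hf.aemeasurable

lemma tsum_lintegral_lintegral_swap {E E' : Type*} [MeasurableSpace E] [MeasurableSpace E']
    {μ : Measure E} {ν : Measure E'} [SFinite μ] [SFinite ν] {g : ℕ → E × E' → ℝ≥0∞}
    (hg : ∀ j, Measurable (g j)) :
    ∑' j, ∫⁻ x, (∫⁻ y, g j (x, y) ∂ν) ∂μ = ∫⁻ y, (∫⁻ x, ∑' j, g j (x, y) ∂μ) ∂ν := by
  simp_rw [fun j => lintegral_lintegral_swap (μ := μ) (ν := ν) (f := fun x y => g j (x, y))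
    (hg j).aemeasurable]
  rw [← lintegral_tsum fun j => (hg j).lintegral_prod_left'.aemeasurable]
  exact lintegral_congr fun y =>
    (lintegral_tsum fun j => ((hg j).comp measurable_prodMk_right).aemeasurable).symm

lemma interferenceExponent_mono {α A T : ℝ} (hα : 0 ≤ α) (hA : 0 < A) {r r' : ℝ} (hr : 0 ≤ r)
    (hrr' : r ≤ r') (s : ℝ) :
    interferenceExponent (fun r => A * r ^ α) T r s ≤
      interferenceExponent (fun r => A * r ^ α) T r' s := by
  unfold interferenceExponent
  refine negLog_antitone (ENNReal.inv_le_inv.2 ?_)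
  gcongr
  exact mul_le_mul_of_nonneg_left (Real.rpow_le_rpow hr hrr' hα) hA.le

lemma interferenceExponent_ne_top {ℓ : ℝ → ℝ} {T r s : ℝ} (hs : 0 < ℓ s) :
    interferenceExponent ℓ T r s ≠ ∞ := by
  refine negLog_ne_top (ENNReal.inv_ne_zero.2 (ENNReal.add_ne_top.2 ⟨ENNReal.one_ne_top, ?_⟩))
  exact ENNReal.div_ne_top (ENNReal.mul_ne_top ENNReal.ofReal_ne_top ENNReal.ofReal_ne_top)
    (by simpa using hs)

lemma successProb_pow (ℓ : ℝ → ℝ) (T : ℝ) (j : ℕ) (x : ℕ → Plane) (y : Plane) (n : ℕ) :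
    successProb ℓ T j x y ^ n = expNeg (∑' i, if i = j then 0 else
      (n : ℝ≥0∞) * interferenceExponent ℓ T (dist (x j) y) (dist (x i) y)) := by
  rw [successProb, ← expNeg_nat_mul, ← ENNReal.tsum_mul_left]
  simp only [mul_ite, mul_zero]

/-! ### Moments of the success probability and the exact formula -/

namespace Network

variable {Ω : Type*} [MeasurableSpace Ω] {P : Measure Ω} {lamM lamR R : ℝ}
  (N : Network Ω P lamM lamR R)

/-- The set of triples (index of a transmitter in `B`, outcome, point of its disc). -/
def linkSet (B : Set Plane) : Set (ℕ × (Ω × Plane)) :=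
  {q | N.tx q.1 q.2.1 ∈ B ∩ Metric.ball q.2.2 R}

/-- The intensity measure of the links of the transmitters in `B`. -/
noncomputable def linkMeasure (B : Set Plane) : Measure (ℕ × (Ω × Plane)) :=
  (Measure.count.prod (P.prod volume)).restrict (N.linkSet B)

/-- The probability of a successful transmission on a link. -/
noncomputable def linkProb (ℓ : ℝ → ℝ) (T : ℝ) (q : ℕ × (Ω × Plane)) : ℝ≥0∞ :=
  successProb ℓ T q.1 (fun i => N.tx i q.2.1) q.2.2

lemma measurableSet_linkSet {B : Set Plane} (hB : MeasurableSet B) :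
    MeasurableSet (N.linkSet B) := by
  have h1 : ∀ j, MeasurableSet {p : Ω × Plane | N.tx j p.1 ∈ B ∧ dist (N.tx j p.1) p.2 < R} :=
    fun j => (((N.tx_measurable j).comp measurable_fst) hB).inter
      (measurableSet_lt (((N.tx_measurable j).comp measurable_fst).dist measurable_snd)
        measurable_const)
  have h2 : N.linkSet B = ⋃ j, ({j} : Set ℕ) ×ˢ
      {p : Ω × Plane | N.tx j p.1 ∈ B ∧ dist (N.tx j p.1) p.2 < R} := by
    ext ⟨j, ω, y⟩
    simp [linkSet]
  rw [h2]
  exact MeasurableSet.iUnion fun j => (measurableSet_singleton j).prod (h1 j)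

lemma measurable_linkProb {ℓ : ℝ → ℝ} (hℓ : Measurable ℓ) (T : ℝ) :
    Measurable (N.linkProb ℓ T) :=
  measurable_from_prod_countable_right fun j => measurable_successProb hℓ T j
    (fun i => (N.tx_measurable i).comp measurable_fst) measurable_snd

open Classical in
lemma meanCovered_mono (B : Set Plane) (ℓ : ℝ → ℝ) (W T : ℝ) {τ τ' : ℕ} (h : τ ≤ τ') :
    N.meanCovered B ℓ W T τ ≤ N.meanCovered B ℓ W T τ' := by
  unfold meanCovered palmExpectation
  refine ENNReal.div_le_div_right (lintegral_mono fun ω => ENNReal.tsum_le_tsum fun j =>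
    Set.indicator_le_indicator ?_) _
  rw [Nat.cast_le]
  unfold numCovered
  exact Finset.card_le_card (Finset.monotone_filter_right _ fun k _ ⟨n, hn, hT⟩ =>
    ⟨n, Finset.Icc_subset_Icc_right h hn, hT⟩)

variable [IsProbabilityMeasure P]

/-- The n-th power multiplies the interference exponent by n, so this is Mecke's formula with the
exponent depending on the transmitter only through its distance to the fixed receiver `y`. -/
lemma lintegral_tsum_successProb_pow {α A T : ℝ} (hα : 2 < α) (hA : 0 < A) (hT : 0 < T)
    (hlamM : 0 < lamM) {B : Set Plane} (hB : MeasurableSet B) (hBfin : volume B ≠ ∞) (n : ℕ)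
    (y : Plane) :
    ∫⁻ ω, ∑' j, (B ∩ Metric.ball y R).indicator (fun _ =>
        successProb (fun r => A * r ^ α) T j (fun i => N.tx i ω) y ^ n) (N.tx j ω) ∂P =
      ENNReal.ofReal lamM * ∫⁻ x in B ∩ Metric.ball y R,
        ENNReal.ofReal (Real.exp (-(lamM * (K α n * T ^ (2 / α)) * dist x y ^ 2))) := by
  have hα0 : 0 < α := by linarith
  have hℓ : Measurable fun r : ℝ => A * r ^ α := by fun_prop
  -- The case n = 0, where `K` vanishes, is kept: it computes the total mass of `linkMeasure`.
  have hK0 : 0 ≤ K α n := by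
    rcases Nat.eq_zero_or_pos n with rfl | hn
    · simp [K]
    · exact (K_pos hα hn).le
  have hT0 : 0 ≤ T ^ (2 / α) := Real.rpow_nonneg hT.le _
  have hσ : SigmaFinite (ENNReal.ofReal lamM • (volume : Measure Plane)) :=
    inferInstanceAs (SigmaFinite (Real.toNNReal lamM • (volume : Measure Plane)))
  have hD : ∀ r : ℝ, 0 ≤ r → expNeg (∫⁻ z, (1 - expNeg (n *
      interferenceExponent (fun r => A * r ^ α) T r (dist z y)))
        ∂(ENNReal.ofReal lamM • (volume : Measure Plane))) =
      ENNReal.ofReal (Real.exp (-(lamM * (K α n * T ^ (2 / α)) * r ^ 2))) := fun r hr => by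
    rw [lintegral_smul_measure, lintegral_one_sub_expNeg hα hA hT n y hr, smul_eq_mul,
      ← ENNReal.ofReal_mul hlamM.le, expNeg_ofReal (by positivity)]
    ring_nf
  have hC : MeasurableSet (B ∩ Metric.ball y R) := hB.inter Metric.isOpen_ball.measurableSet
  have hne : ∀ᵐ z : Plane, z ≠ y := by
    rw [ae_iff]
    simp
  have hmecke := N.tx_poisson.mecke_expNeg_monotone N.tx_measurable
    (h := fun r z => n * interferenceExponent (fun r => A * r ^ α) T r (dist z y))
    (fun r => (measurable_interferenceExponent hℓ T measurable_const
      (measurable_id.dist measurable_const)).const_mul _)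
    (fun r _ => Measure.ae_smul_measure (hne.mono fun z hz => ENNReal.mul_ne_top
      (ENNReal.natCast_ne_top n) (interferenceExponent_ne_top
        (mul_pos hA (Real.rpow_pos_of_pos (dist_pos.2 hz) _)))) _)
    (fun z r hr r' _ hrr' => mul_le_mul_right (interferenceExponent_mono hα0.le hA hr hrr' _) _)
    (ContinuousOn.congr (f := fun r =>
      ENNReal.ofReal (Real.exp (-(lamM * (K α n * T ^ (2 / α)) * r ^ 2))))
      (ENNReal.continuous_ofReal.comp (by fun_prop)).continuousOn fun r hr => hD r hr) hC
    (by
      rw [Measure.smul_apply, smul_eq_mul]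
      exact ENNReal.mul_ne_top ENNReal.ofReal_ne_top
        (ne_top_of_le_ne_top hBfin (measure_mono Set.inter_subset_left)))
    (ρ := fun x => dist x y) (measurable_id.dist measurable_const) fun x => dist_nonneg
  have e1 : ∀ ω j, (B ∩ Metric.ball y R).indicator (fun _ =>
      successProb (fun r => A * r ^ α) T j (fun i => N.tx i ω) y ^ n) (N.tx j ω) =
      (B ∩ Metric.ball y R).indicator (fun x => expNeg (∑' i, if i = j then 0 else
        n * interferenceExponent (fun r => A * r ^ α) T (dist x y) (dist (N.tx i ω) y)))
        (N.tx j ω) := fun ω j => by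
    by_cases hx : N.tx j ω ∈ B ∩ Metric.ball y R
    · rw [Set.indicator_of_mem hx, Set.indicator_of_mem hx, successProb_pow]
    · rw [Set.indicator_of_notMem hx, Set.indicator_of_notMem hx]
  simp_rw [e1]
  rw [hmecke, Measure.restrict_smul, lintegral_smul_measure, smul_eq_mul]
  congr 1
  exact lintegral_congr fun x => hD _ dist_nonneg

lemma lintegral_linkMeasure {ℓ : ℝ → ℝ} (hℓ : Measurable ℓ) (T : ℝ) {B : Set Plane}
    (hB : MeasurableSet B) {f : ℝ≥0∞ → ℝ≥0∞} (hf : Measurable f) :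
    ∫⁻ q, f (N.linkProb ℓ T q) ∂(N.linkMeasure B) =
      ∑' j, ∫⁻ ω, (∫⁻ y, (B ∩ Metric.ball y R).indicator
        (fun _ => f (successProb ℓ T j (fun i => N.tx i ω) y)) (N.tx j ω)) ∂P := by
  have hm : Measurable ((N.linkSet B).indicator fun q => f (N.linkProb ℓ T q)) :=
    (hf.comp (N.measurable_linkProb hℓ T)).indicator (N.measurableSet_linkSet hB)
  rw [linkMeasure, ← lintegral_indicator (N.measurableSet_linkSet hB),
    lintegral_prod _ hm.aemeasurable, lintegral_count]
  refine tsum_congr fun j => ?_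
  have hmj : Measurable fun p : Ω × Plane =>
    (N.linkSet B).indicator (fun q => f (N.linkProb ℓ T q)) (j, p) := hm.comp measurable_prodMk_left
  rw [lintegral_prod _ hmj.aemeasurable]
  refine lintegral_congr fun ω => lintegral_congr fun y => ?_
  by_cases hx : N.tx j ω ∈ B ∩ Metric.ball y R
  · rw [Set.indicator_of_mem hx, Set.indicator_of_mem (show (j, ω, y) ∈ N.linkSet B from hx)]
    rfl
  · rw [Set.indicator_of_notMem hx, Set.indicator_of_notMem (show (j, ω, y) ∉ N.linkSet B from hx)]

lemma lintegral_linkMeasure_swap {ℓ : ℝ → ℝ} (hℓ : Measurable ℓ) (T : ℝ) {B : Set Plane}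
    (hB : MeasurableSet B) {f : ℝ≥0∞ → ℝ≥0∞} (hf : Measurable f) :
    ∫⁻ q, f (N.linkProb ℓ T q) ∂(N.linkMeasure B) =
      ∫⁻ y, (∫⁻ ω, ∑' j, (B ∩ Metric.ball y R).indicator
        (fun _ => f (successProb ℓ T j (fun i => N.tx i ω) y)) (N.tx j ω) ∂P) := by
  have hms : ∀ j, MeasurableSet
      {p : Ω × Plane | N.tx j p.1 ∈ B ∩ Metric.ball p.2 R} := fun j =>
    (((N.tx_measurable j).comp measurable_fst) hB).inter
      (measurableSet_lt (((N.tx_measurable j).comp measurable_fst).dist measurable_snd)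
        measurable_const)
  have hm : ∀ j, Measurable fun p : Ω × Plane => (B ∩ Metric.ball p.2 R).indicator
      (fun _ => f (successProb ℓ T j (fun i => N.tx i p.1) p.2)) (N.tx j p.1) := fun j =>
    (hf.comp (measurable_successProb hℓ T j
      (fun i => (N.tx_measurable i).comp measurable_fst) measurable_snd)).indicator (hms j)
  rw [N.lintegral_linkMeasure hℓ T hB hf]
  exact tsum_lintegral_lintegral_swap hm

lemma lintegral_linkProb_pow {α A T : ℝ} (hα : 2 < α) (hA : 0 < A) (hT : 0 < T)
    (hlamM : 0 < lamM) {B : Set Plane} (hB : MeasurableSet B) (hBfin : volume B ≠ ∞) (n : ℕ) :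
    ∫⁻ q, N.linkProb (fun r => A * r ^ α) T q ^ n ∂(N.linkMeasure B) =
      ENNReal.ofReal lamM * ∫⁻ x in B, (∫⁻ y in Metric.ball x R,
        ENNReal.ofReal (Real.exp (-(lamM * (K α n * T ^ (2 / α)) * dist x y ^ 2)))) := by
  have hφ : Measurable fun r : ℝ =>
      ENNReal.ofReal (Real.exp (-(lamM * (K α n * T ^ (2 / α)) * r ^ 2))) := by fun_prop
  rw [N.lintegral_linkMeasure_swap (f := fun p => p ^ n) (by fun_prop) T hB (by fun_prop)]
  simp_rw [N.lintegral_tsum_successProb_pow hα hA hT hlamM hB hBfin n]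
  rw [lintegral_const_mul' _ _ ENNReal.ofReal_ne_top, lintegral_lintegral_ball hφ hB]

/-- The total mass is the zeroth moment, λ_m |B| times the area of a disc. The measure involves
neither the path loss nor the threshold, so α = 3 and A = T = 1 are arbitrary admissible values. -/
lemma isFiniteMeasure_linkMeasure (hlamM : 0 < lamM) {B : Set Plane} (hB : MeasurableSet B)
    (hBfin : volume B ≠ ∞) : IsFiniteMeasure (N.linkMeasure B) := by
  have h := N.lintegral_linkProb_pow (α := 3) (A := 1) (T := 1) (by norm_num) one_pos one_pos
    hlamM hB hBfin 0
  refine ⟨?_⟩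
  simp only [pow_zero, lintegral_one, K, one_div, inv_one, sub_self, mul_zero, integral_zero,
    zero_mul, neg_zero, Real.exp_zero, ENNReal.ofReal_one, EuclideanSpace.volume_ball_fin_two,
    Measure.restrict_apply_univ, lintegral_const] at h
  rw [h]
  finiteness

lemma toReal_lintegral_linkProb_pow {α A T : ℝ} (hα : 2 < α) (hA : 0 < A) (hT : 0 < T)
    (hR : 0 < R) (hlamM : 0 < lamM) {B : Set Plane} (hB : MeasurableSet B)
    (hBfin : volume B ≠ ∞) {n : ℕ} (hn : 1 ≤ n) :
    (∫⁻ q, N.linkProb (fun r => A * r ^ α) T q ^ n ∂(N.linkMeasure B)).toReal =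
      (volume B).toReal * (Real.pi / (K α n * T ^ (2 / α)) *
        (1 - Real.exp (-(lamM * K α n * T ^ (2 / α) * R ^ 2)))) := by
  have hc : 0 < lamM * (K α n * T ^ (2 / α)) :=
    mul_pos hlamM (mul_pos (K_pos hα hn) (Real.rpow_pos_of_pos hT _))
  rw [N.lintegral_linkProb_pow hα hA hT hlamM hB hBfin n]
  simp_rw [lintegral_ball_exp hc hR]
  have hexp : 0 ≤ 1 - Real.exp (-(lamM * (K α n * T ^ (2 / α)) * R ^ 2)) := by
    rw [sub_nonneg, Real.exp_le_one_iff]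
    have := mul_pos hc (pow_pos hR 2)
    linarith
  rw [lintegral_const, Measure.restrict_apply_univ, ENNReal.toReal_mul, ENNReal.toReal_mul,
    ENNReal.toReal_ofReal hlamM.le, ENNReal.toReal_ofReal (mul_nonneg (by positivity) hexp)]
  rw [← mul_assoc lamM (K α n)]
  field_simp

lemma meanCovered_eq {α A T : ℝ} (hA : 0 < A) (τ : ℕ) {B : Set Plane}
    (hB : MeasurableSet B) :
    N.meanCovered B (fun r => A * r ^ α) 0 T τ =
      ENNReal.ofReal lamR * (∫⁻ q, (1 - (1 - N.linkProb (fun r => A * r ^ α) T q) ^ τ)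
        ∂(N.linkMeasure B)) / (ENNReal.ofReal lamM * volume B) := by
  have hℓ : Measurable fun r : ℝ => A * r ^ α := by fun_prop
  have hpos : ∀ r : ℝ, 0 < r → 0 < A * r ^ α := fun r hr =>
    mul_pos hA (Real.rpow_pos_of_pos hr _)
  rw [meanCovered, palmExpectation, N.lintegral_tsum_numCovered hℓ hpos T τ hB,
    N.lintegral_linkMeasure (f := fun p => 1 - (1 - p) ^ τ) hℓ T hB (by fun_prop)]
  simp only [coverProb]

/-- The mean number of covered receivers in the typical cluster. -/
theorem meanCovered_formula {α A T : ℝ} (hα : 2 < α) (hA : 0 < A) (hT : 0 < T) (hR : 0 < R)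
    (hlamR : 0 < lamR) (hlamM : 0 < lamM) (τ : ℕ) {B : Set Plane} (hB : MeasurableSet B)
    (hB0 : volume B ≠ 0) (hBfin : volume B ≠ ∞) :
    N.meanCovered B (fun r => A * r ^ α) 0 T τ ≠ ∞ ∧
      (N.meanCovered B (fun r => A * r ^ α) 0 T τ).toReal =
        Real.pi * lamR / (T ^ (2 / α) * lamM) *
          ∑ n ∈ Finset.Icc 1 τ, (-1 : ℝ) ^ (n + 1) * (τ.choose n : ℝ) *
            (1 / K α n * (1 - Real.exp (-(lamM * K α n * T ^ (2 / α) * R ^ 2)))) := by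
  have hfin := N.isFiniteMeasure_linkMeasure hlamM hB hBfin
  have hℓ : Measurable fun r : ℝ => A * r ^ α := by fun_prop
  rw [N.meanCovered_eq hA τ hB]
  have hI : ∫⁻ q, (1 - (1 - N.linkProb (fun r => A * r ^ α) T q) ^ τ) ∂(N.linkMeasure B) ≠ ∞ :=
    ne_top_of_le_ne_top (measure_ne_top (N.linkMeasure B) Set.univ)
      ((lintegral_mono fun q => tsub_le_self).trans (lintegral_one).le)
  constructor
  · refine ENNReal.div_ne_top (ENNReal.mul_ne_top ENNReal.ofReal_ne_top hI) (mul_ne_zero ?_ hB0)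
    simpa using hlamM
  · have hV : 0 < (volume B).toReal := ENNReal.toReal_pos hB0 hBfin
    have hTp : 0 < T ^ (2 / α) := Real.rpow_pos_of_pos hT _
    rw [ENNReal.toReal_div, ENNReal.toReal_mul, ENNReal.toReal_mul,
      ENNReal.toReal_ofReal hlamR.le, ENNReal.toReal_ofReal hlamM.le,
      toReal_lintegral_one_sub_pow (N.measurable_linkProb hℓ T)
        (fun q => successProb_le_one _ _ _ _ _) τ, Finset.mul_sum, Finset.sum_div, Finset.mul_sum]
    refine Finset.sum_congr rfl fun n hn => ?_
    have hn1 := (Finset.mem_Icc.1 hn).1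
    rw [N.toReal_lintegral_linkProb_pow hα hA hT hR hlamM hB hBfin hn1]
    have hK := K_pos hα hn1
    field_simp

end Network

/-! ### Dense limit and main theorem -/

lemma tendsto_sum_Ktilde {ι : Type*} {F : Filter ι} {lamM : ι → ℝ} (hlim : Tendsto lamM F atTop)
    {α T R : ℝ} (hα : 2 < α) (hT : 0 < T) (hR : 0 < R) (τ : ℕ) :
    Tendsto (fun i => ∑ n ∈ Finset.Icc 1 τ, (-1 : ℝ) ^ (n + 1) * (τ.choose n : ℝ) *
      (1 / K α n * (1 - Real.exp (-(lamM i * K α n * T ^ (2 / α) * R ^ 2))))) F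
      (𝓝 (Ktilde α τ)) := by
  unfold Ktilde
  refine tendsto_finsetSum _ fun n hn => Tendsto.const_mul _ ?_
  have hc : 0 < K α n * T ^ (2 / α) * R ^ 2 :=
    mul_pos (mul_pos (K_pos hα (Finset.mem_Icc.1 hn).1) (Real.rpow_pos_of_pos hT _))
      (pow_pos hR 2)
  have h1 : Tendsto (fun i => Real.exp (-(lamM i * K α n * T ^ (2 / α) * R ^ 2))) F (𝓝 0) := by
    refine Real.tendsto_exp_neg_atTop_nhds_zero.comp ?_
    simp_rw [mul_assoc]
    refine hlim.atTop_mul_const ?_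
    simpa only [mul_assoc] using hc
  simpa using (h1.const_sub 1).const_mul (1 / K α n)

end MulticastD2D

theorem corollary2 (α A T R lamR : ℝ) (τ : ℕ) (hα : 2 < α) (hA : 0 < A) (hT : 0 < T)
    (hR : 0 < R) (hlamR : 0 < lamR) (hτ : 1 ≤ τ) :
    (∀ (Ω : Type*) [MeasurableSpace Ω] (P : Measure Ω) [IsProbabilityMeasure P]
        (lamM : ℝ) (_ : 0 < lamM) (N : MulticastD2D.Network Ω P lamM lamR R)
        (B : Set MulticastD2D.Plane) (_ : MeasurableSet B) (_ : volume B ≠ 0)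
        (_ : volume B ≠ ∞),
      N.meanCovered B (fun r => A * r ^ α) 0 T τ ≠ ∞ ∧
      (N.meanCovered B (fun r => A * r ^ α) 0 T τ).toReal =
        Real.pi * lamR / (T ^ (2 / α) * lamM) *
          ∑ n ∈ Finset.Icc 1 τ, (-1 : ℝ) ^ (n + 1) * (τ.choose n : ℝ) *
            (1 / MulticastD2D.K α n *
              (1 - Real.exp (-(lamM * MulticastD2D.K α n * T ^ (2 / α) * R ^ 2))))) ∧
    (∀ (ι : Type*) (F : Filter ι) (lamM : ι → ℝ) (_ : ∀ i, 0 < lamM i)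
        (_ : Tendsto lamM F atTop)
        (Ω : ι → Type*) [∀ i, MeasurableSpace (Ω i)] (P : ∀ i, Measure (Ω i))
        [∀ i, IsProbabilityMeasure (P i)]
        (N : ∀ i, MulticastD2D.Network (Ω i) (P i) (lamM i) lamR R)
        (B : ι → Set MulticastD2D.Plane) (_ : ∀ i, MeasurableSet (B i))
        (_ : ∀ i, volume (B i) ≠ 0) (_ : ∀ i, volume (B i) ≠ ∞),
      (fun i => ((N i).meanCovered (B i) (fun r => A * r ^ α) 0 T τ).toReal) ~[F]
        (fun i => Real.pi * MulticastD2D.Ktilde α τ * lamR / (T ^ (2 / α) * lamM i))) := by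
  constructor
  · intro Ω _ P _ lamM hlamM N B hB hB0 hBfin
    exact N.meanCovered_formula hα hA hT hR hlamR hlamM τ hB hB0 hBfin
  · intro ι F lamM hlamM hlim Ω _ P _ N B hB hB0 hBfin
    -- The comparison of limits below needs a nontrivial filter; along the trivial one every
    -- equivalence holds.
    rcases F.eq_or_neBot with rfl | hF
    · exact isLittleO_bot (E := ℝ) (F := ℝ) _ _
    have hform := fun (σ : ℕ) i =>
      (N i).meanCovered_formula hα hA hT hR hlamR (hlamM i) σ (hB i) (hB0 i) (hBfin i)
    have hTp : 0 < T ^ (2 / α) := Real.rpow_pos_of_pos hT _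
    have hcoef : ∀ i, 0 < Real.pi * lamR / (T ^ (2 / α) * lamM i) := fun i => by
      have := hlamM i
      positivity
    have hlimτ := MulticastD2D.tendsto_sum_Ktilde hlim hα hT hR τ
    have hlim1 := MulticastD2D.tendsto_sum_Ktilde hlim hα hT hR 1
    -- The mean for τ transmissions dominates the mean for one in the same network. Dividing by the
    -- common positive prefactor and passing to the limit gives `Ktilde α 1 ≤ Ktilde α τ`.
    have hKt : 0 < MulticastD2D.Ktilde α τ := by
      have h1 : 0 < MulticastD2D.Ktilde α 1 := by
        have := MulticastD2D.K_pos hα le_rfl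
        simpa [MulticastD2D.Ktilde] using this
      refine h1.trans_le (le_of_tendsto_of_tendsto' hlim1 hlimτ fun i => ?_)
      refine le_of_mul_le_mul_left ?_ (hcoef i)
      rw [← (hform 1 i).2, ← (hform τ i).2]
      exact ENNReal.toReal_mono (hform τ i).1 ((N i).meanCovered_mono _ _ _ _ hτ)
    refine isEquivalent_of_tendsto_one ?_
    have hdiv := hlimτ.div_const (MulticastD2D.Ktilde α τ)
    rw [div_self hKt.ne'] at hdiv
    refine hdiv.congr fun i => ?_
    rw [Pi.div_apply, (hform τ i).2,
      show Real.pi * MulticastD2D.Ktilde α τ * lamR / (T ^ (2 / α) * lamM i) =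
        Real.pi * lamR / (T ^ (2 / α) * lamM i) * MulticastD2D.Ktilde α τ by ring,
      mul_div_mul_left _ _ (hcoef i).ne']
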